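/- By a list of Seifert invariants $\{e;(\epsilon,g);(a_1,b_1),\ldots,(a_n,b_n)\}$ we mean: an integer $e$; a type $\epsilon\in\{o_1,o_2,n_1,n_2,n_3,n_4\}$; an integer $g\ge 0$, with $g\ge 1$ if $\epsilon\in\{o_2,n_1,n_2\}$, $g\ge 2$ if $\epsilon=n_3$ and $g\ge 3$ if $\epsilon=n_4$; and $n\ge 0$ pairs of coprime integers $(a_k,b_k)$ with $a_k\neq 0$ (not necessarily normalized). The fundamental group of the Seifert manifold with these invariants is given by the presentation $$\left\langle s_1,\ldots,s_n,\ v_1,\ldots,v_{g'},\ h\ \middle|\ [s_k,h],\ s_k^{a_k}h^{b_k}\ (1\le k\le n);\ v_jhv_j^{-1}h^{-\varepsilon_j}\ (1\le j\le g');\ h^{-e}s_1\cdots s_nV\right\rangle,$$ where $[x,y]=xyx^{-1}y^{-1}$ and: if $\epsilon\in\{o_1,o_2\}$ (orientable base), $g'=2g$ and $V=[v_1,v_2]\cdots[v_{2g-1},v_{2g}]$; if $\epsilon\in\{n_1,n_2,n_3,n_4\}$ (non-orientable base), $g'=g$ and $V=v_1^2\cdots v_g^2$; all $\varepsilon_j=1$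 for $\epsilon=o_1,n_1$; all $\varepsilon_j=-1$ for $\epsilon=o_2,n_2$; all $\varepsilon_j=-1$ except $\varepsilon_1=1$ for $\epsilon=n_3$; all $\varepsilon_j=-1$ except $\varepsilon_1=\varepsilon_2=1$ for $\epsilon=n_4$. **Theorem.** Let $\pi_1(N)$ be the fundamental group given by a list of Seifert invariants $\{e;(\epsilon,g);(a_1,b_1),\ldots,(a_n,b_n)\}$, let $0<m\le n$, and let $\varphi:\pi_1(N)\to\mathbb{Z}/2$ be a homomorphism with $\varphi(s_1)=\cdots=\varphi(s_m)=1$ and $\varphi(h)=\varphi(s_{m+1})=\cdots=\varphi(s_n)=0$ (the values $\varphi(v_j)$ being arbitrary). Then $m$ and $a_1,\ldots,a_m$ are even, $\{e';(\epsilon',G);F_m\}$ defined below is again a list of Seifert invariants, and $\ker\varphi$ is isomorphic to the fundamental group of the Seifert manifold with invariants $\{e';(\epsilon',G);F_m\}$, where $$e'=\begin{cases}2e&\text{if }\epsilon=o_1,n_2\\0&\text{if }\epsilon=o_2,n_1,n_3,n_4\end{cases}\qquad \epsilon'=\begin{cases}\epsilon&\text{if }\epsilon=o_1,o_2,n_1,n_2,n_4\\n_4&\text{if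 }\epsilon=n_3\end{cases}$$ $$G=\begin{cases}\frac m2-1+2g&\text{if }\epsilon=o_1,o_2\\m-2+2g&\text{if }\epsilon=n_1,n_2,n_3,n_4\end{cases}$$ and $$F_m=(a_1/2,b_1),\ldots,(a_m/2,b_m),(a_{m+1},b_{m+1}),(a_{m+1},b_{m+1}),\ldots,(a_n,b_n),(a_n,b_n).$$ -/

import Mathlib

/-- The six types of a Seifert fibration. The base surface is orientable for `o1`, `o2` and
non-orientable for `n1`, `n2`, `n3`, `n4`. -/
inductive SeifertType where
  | o1 | o2 | n1 | n2 | n3 | n4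

namespace SeifertType

/-- The number `g'` of generators `v_j`: `2 g` if the base is orientable, `g` otherwise. -/
def numV : SeifertType → ℕ → ℕ
  | o1, g => 2 * g
  | o2, g => 2 * g
  | n1, g => g
  | n2, g => g
  | n3, g => g
  | n4, g => g

/-- The smallest genus allowed for each type. -/
def minGenus : SeifertType → ℕ
  | o1 => 0
  | o2 => 1
  | n1 => 1
  | n2 => 1
  | n3 => 2
  | n4 => 3

/-- The sign `ε_j`, where `j` is counted from `0`. -/
def sign : SeifertType → ℕ → ℤ
  | o1, _ => 1
  | o2, _ => -1
  | n1, _ => 1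
  | n2, _ => -1
  | n3, j => if j < 1 then 1 else -1
  | n4, j => if j < 2 then 1 else -1

/-- `[x, y] = x y x⁻¹ y⁻¹`. -/
def commutator {G : Type*} [Group G] (x y : G) : G := x * y * x⁻¹ * y⁻¹

/-- `[v_1, v_2] [v_3, v_4] ⋯ [v_{2g-1}, v_{2g}]`. -/
def commutatorProd {G : Type*} [Group G] (g : ℕ) (v : Fin (2 * g) → G) : G :=
  (List.ofFn fun i : Fin g =>
    commutator (v ⟨2 * i.val, by omega⟩) (v ⟨2 * i.val + 1, by omega⟩)).prod

/-- `v_1² v_2² ⋯ v_g²`. -/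
def squareProd {G : Type*} [Group G] (g : ℕ) (v : Fin g → G) : G :=
  (List.ofFn fun j : Fin g => v j ^ 2).prod

/-- The word `V` in the long relator. -/
def surfaceWord {G : Type*} [Group G] : (t : SeifertType) → (g : ℕ) → (Fin (t.numV g) → G) → G
  | o1, g, v => commutatorProd g v
  | o2, g, v => commutatorProd g v
  | n1, g, v => squareProd g v
  | n2, g, v => squareProd g v
  | n3, g, v => squareProd g v
  | n4, g, v => squareProd g v

end SeifertType

/-- A list `{e; (ε, g); (a_1, b_1), …, (a_n, b_n)}`. -/
structure SeifertData where
  e : ℤ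
  type : SeifertType
  g : ℕ
  fibres : List (ℤ × ℤ)

/-- Generators `s_1, …, s_n`, `v_1, …, v_p`, `h`. -/
inductive SeifertGen (n p : ℕ) where
  | s (k : Fin n)
  | v (j : Fin p)
  | h

namespace SeifertData

/-- The list is a list of (not necessarily normalized) Seifert invariants: the genus is allowed
for the type, each `a_k` is nonzero and each `a_k` is coprime to `b_k`. -/
def IsValid (S : SeifertData) : Prop :=
  S.type.minGenus ≤ S.g ∧ ∀ p ∈ S.fibres, p.1 ≠ 0 ∧ IsCoprime p.1 p.2

/-- The number `n` of the generators `s_k`. -/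
abbrev n (S : SeifertData) : ℕ := S.fibres.length

/-- The number `g'` of the generators `v_j`. -/
abbrev g' (S : SeifertData) : ℕ := S.type.numV S.g

/-- The integer `a_k`, where `k` is counted from `0`. -/
def a (S : SeifertData) (k : Fin S.n) : ℤ := (S.fibres.get k).1

/-- The integer `b_k`, where `k` is counted from `0`. -/
def b (S : SeifertData) (k : Fin S.n) : ℤ := (S.fibres.get k).2

/-- The free group on the generators. -/
abbrev Free (S : SeifertData) : Type := FreeGroup (SeifertGen S.n S.g')

/-- The letter `s_k` of the free group. -/
def fs (S : SeifertData) (k : Fin S.n) : S.Free := FreeGroup.of (SeifertGen.s k)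

/-- The letter `v_j` of the free group. -/
def fv (S : SeifertData) (j : Fin S.g') : S.Free := FreeGroup.of (SeifertGen.v j)

/-- The letter `h` of the free group. -/
def fh (S : SeifertData) : S.Free := FreeGroup.of SeifertGen.h

/-- The relators of the fundamental group: `[s_k, h]`, `s_k ^ a_k h ^ b_k`,
`v_j h v_j⁻¹ h ^ (-ε_j)` and `h ^ (-e) s_1 ⋯ s_n V`. -/
inductive Relator (S : SeifertData) : S.Free → Prop
  | comm (k : Fin S.n) : Relator S (SeifertType.commutator (S.fs k) S.fh)
  | fibre (k : Fin S.n) : Relator S (S.fs k ^ S.a k * S.fh ^ S.b k)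
  | conj (j : Fin S.g') :
      Relator S (S.fv j * S.fh * (S.fv j)⁻¹ * S.fh ^ (-S.type.sign j.val))
  | long : Relator S
      (S.fh ^ (-S.e) * (List.ofFn S.fs).prod * S.type.surfaceWord S.g S.fv)

/-- The fundamental group of the Seifert manifold with invariants `S`. -/
abbrev Pi1 (S : SeifertData) : Type := PresentedGroup {r : S.Free | S.Relator r}

/-- The element `s_k` of the fundamental group. -/
def s (S : SeifertData) (k : Fin S.n) : S.Pi1 := PresentedGroup.of (SeifertGen.s k)

/-- The element `v_j` of the fundamental group. -/
def v (S : SeifertData) (j : Fin S.g') : S.Pi1 := PresentedGroup.of (SeifertGen.v j)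

/-- The element `h` of the fundamental group: the class of the regular fibre. -/
def h (S : SeifertData) : S.Pi1 := PresentedGroup.of SeifertGen.h

/-- The integer `e'`: `2 e` for the types `o1`, `n2`, and `0` otherwise. -/
def coverE (S : SeifertData) : ℤ :=
  match S.type with
  | .o1 => 2 * S.e
  | .n2 => 2 * S.e
  | .o2 => 0
  | .n1 => 0
  | .n3 => 0
  | .n4 => 0

/-- The type `ε'`: equal to `ε`, except that `n3` becomes `n4`. -/
def coverType (S : SeifertData) : SeifertType :=
  match S.type with
  | .n3 => .n4
  | t => t

/-- The genus `G`: `m / 2 - 1 + 2 g` if the base is orientable, `m - 2 + 2 g` otherwise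
(to be used for `m` even and positive). -/
def coverG (S : SeifertData) (m : ℕ) : ℕ :=
  match S.type with
  | .o1 => m / 2 - 1 + 2 * S.g
  | .o2 => m / 2 - 1 + 2 * S.g
  | .n1 => m - 2 + 2 * S.g
  | .n2 => m - 2 + 2 * S.g
  | .n3 => m - 2 + 2 * S.g
  | .n4 => m - 2 + 2 * S.g

/-- The list `F_m`: `(a_1 / 2, b_1), …, (a_m / 2, b_m)`, followed by
`(a_{m+1}, b_{m+1}), (a_{m+1}, b_{m+1}), …, (a_n, b_n), (a_n, b_n)`
(to be used when `a_1, …, a_m` are even). -/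
def coverFibres (S : SeifertData) (m : ℕ) : List (ℤ × ℤ) :=
  (S.fibres.take m).map (fun p => (p.1 / 2, p.2)) ++ (S.fibres.drop m).flatMap (fun p => [p, p])

/-- The list `{e'; (ε', G); F_m}`. -/
def cover (S : SeifertData) (m : ℕ) : SeifertData where
  e := S.coverE
  type := S.coverType
  g := S.coverG m
  fibres := S.coverFibres m

end SeifertData

/-!
The fundamental group of a Seifert manifold is described by its functor of points: homomorphisms
out of it are the same as tuples of elements that satisfy the relators. The long relator is cut
into *blocks* (exceptional fibres, handles, cross-caps, a power of the regular fibre `h`), each of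
which is a functor of tuples with a natural value, and the relator says that the product of the
values is `1`. All values commute with `h`, so two neighbouring blocks can be interchanged at the
cost of a conjugation. Hence the isomorphism classes of blocks form a commutative monoid
`BlockClass`, and the manipulations of words known from the classification of surfaces become
equations in it: a handle next to a cross-cap equals two more cross-caps
(`Block.cls_handle_mul_crosscap`), an exceptional fibre can be slid over a handle or a cross-cap
(`Block.cls_coneBlock_mul_handle`, `Block.cls_coneBlock_mul_crosscap`), and so on. Equal classes
present the same group (`Block.Presents.of_cls_eq`).

All groups carry a degree in `ℤ/2`, which is `φ` on the given group. An exceptional fibre of odd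
degree changes the degree of a generator `v_j` when it is slid over it, so all `v_j` may be assumed
to have degree `0`; this replaces `b_1` by `± b_1` (`Block.exists_slide_surface`). Then the part of
the base without the `m` branch points lifts to two disjoint copies of itself.

Homomorphisms from the kernel of the degree to a group `H` correspond to homomorphisms from the
whole group to the wreath product of `H` with `ℤ/2` that are normalized on one element of odd
degree. Solving the relations in the wreath product, a block of generators of degree `0` gives two
copies of the block, and the `m` branched exceptional fibres give `m` exceptional fibres and
`m / 2 - 1` handles: this is `PairBlock.normalizedOddPairIso` for the first two and
`PairBlock.factoredConePair` for every further pair. The two rows of the long relator are relations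
`X u = 1` and `Y u' = 1`, where `X` is free and `Y X` is a product of values of blocks, so that
together they amount to one long relator (`Block.presents_ker`).

It remains to compare two elements of `BlockClass`. The handles are absorbed in the surface
(`Block.cls_handle_pow_mul_evenSurface_sq`). If the total space is orientable, that is, for the
types `o1` and `n2`, the sign of `b_1` did not change and `e' = 2 e`; otherwise even powers of `h`
and the signs of the `b_k` do not matter (`Block.absorb_evenSurface`).
-/

/-! ### Fibred groups and blocks -/

/-- A group with a distinguished element `fibre`, standing for the class of the regular fibre, and
a homomorphism `deg` to `ℤ/2` that kills it. -/
structure FibredGroup where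
  carrier : Type
  [group : Group carrier]
  fibre : carrier
  deg : carrier →* Multiplicative (ZMod 2)
  deg_fibre : deg fibre = 1

namespace FibredGroup

instance : CoeSort FibredGroup Type := ⟨carrier⟩

instance (H : FibredGroup) : Group H := H.group

/-- Homomorphisms respecting the distinguished elements and the degrees. -/
structure Hom (H K : FibredGroup) extends H →* K where
  map_fibre' : toFun H.fibre = K.fibre
  deg_map' : ∀ x, K.deg (toFun x) = H.deg x

namespace Hom

variable {H K L : FibredGroup}

instance : FunLike (Hom H K) H K where
  coe f := f.toFun
  coe_injective f g h := by
    cases f; cases g; congr; exact DFunLike.coe_injective h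

instance : MonoidHomClass (Hom H K) H K where
  map_mul f := f.map_mul'
  map_one f := f.map_one'

@[ext] theorem ext {f g : Hom H K} (h : ∀ x, f x = g x) : f = g := DFunLike.ext _ _ h

@[simp] theorem map_fibre (f : Hom H K) : f H.fibre = K.fibre := f.map_fibre'

@[simp] theorem deg_map (f : Hom H K) (x : H) : K.deg (f x) = H.deg x := f.deg_map' x

/-- The identity. -/
def id (H : FibredGroup) : Hom H H := ⟨MonoidHom.id H, rfl, fun _ => rfl⟩

/-- Composition. -/
def comp (g : Hom K L) (f : Hom H K) : Hom H L :=
  ⟨g.toMonoidHom.comp f.toMonoidHom, by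
    change g (f H.fibre) = L.fibre
    simp, fun x => by
    change L.deg (g (f x)) = H.deg x
    simp⟩

@[simp] theorem id_apply (x : H) : Hom.id H x = x := rfl

@[simp] theorem comp_apply (g : Hom K L) (f : Hom H K) (x : H) : g.comp f x = g (f x) := rfl

/-- The inner automorphism given by an element that commutes with the fibre. -/
def conj (g : H) (hg : Commute g H.fibre) : Hom H H :=
  ⟨(MulAut.conj g).toMonoidHom, by
    change g * H.fibre * g⁻¹ = H.fibre
    rw [hg.eq, mul_inv_cancel_right], fun x => by
    change H.deg (g * x * g⁻¹) = H.deg x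
    simp⟩

@[simp] theorem conj_apply (g : H) (hg : Commute g H.fibre) (x : H) :
    conj g hg x = g * x * g⁻¹ := rfl

end Hom

/-- The pairs consisting of a degree in `ℤ/2` and the sign with which conjugation acts on the
fibre. -/
abbrev ElementType : Type := Multiplicative (ZMod 2) × ℤˣ

theorem ElementType.mul_self (τ : ElementType) : τ * τ = 1 := by
  obtain ⟨d, ε⟩ := τ
  refine Prod.ext ?_ (Int.units_mul_self ε)
  change d * d = 1
  revert d
  decide

theorem ElementType.inv_eq (τ : ElementType) : τ⁻¹ = τ :=
  inv_eq_of_mul_eq_one_left τ.mul_self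

theorem ElementType.mul_self_cancel (τ σ : ElementType) : τ * (τ * σ) = σ := by
  rw [← mul_assoc, τ.mul_self, one_mul]

/-- The element `x` has degree `τ.1`, and conjugation by `x` raises the fibre to the power
`τ.2 = ±1`. -/
def HasType {H : FibredGroup} (x : H) (τ : ElementType) : Prop :=
  H.deg x = τ.1 ∧ x * H.fibre * x⁻¹ = H.fibre ^ (τ.2 : ℤ)

namespace HasType

variable {H K : FibredGroup} {x y : H} {τ σ : ElementType}

theorem congr (hx : HasType x τ) (h : τ = σ) : HasType x σ := h ▸ hx

theorem fibre : HasType H.fibre 1 := by simp [HasType, H.deg_fibre]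

theorem conj_fibre_zpow (hx : HasType x τ) (n : ℤ) :
    x * H.fibre ^ n * x⁻¹ = H.fibre ^ ((τ.2 : ℤ) * n) := by
  rw [← conj_zpow, hx.2, zpow_mul]

theorem mul (hx : HasType x τ) (hy : HasType y σ) : HasType (x * y) (τ * σ) := by
  refine ⟨by simp [hx.1, hy.1], ?_⟩
  have : x * y * H.fibre * (x * y)⁻¹ = x * (y * H.fibre * y⁻¹) * x⁻¹ := by group
  rw [this, hy.2, hx.conj_fibre_zpow]
  simp

theorem inv (hx : HasType x τ) : HasType x⁻¹ τ := by
  refine ⟨by rw [map_inv, hx.1]; exact congrArg Prod.fst τ.inv_eq, ?_⟩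
  have h := hx.conj_fibre_zpow (τ.2 : ℤ)
  rw [← Units.val_mul, Int.units_mul_self, Units.val_one, zpow_one] at h
  calc x⁻¹ * H.fibre * x⁻¹⁻¹ = x⁻¹ * (x * H.fibre ^ (τ.2 : ℤ) * x⁻¹) * x⁻¹⁻¹ := by rw [h]
    _ = _ := by group

theorem map (f : Hom H K) (hx : HasType x τ) : HasType (f x) τ := by
  refine ⟨by simp [hx.1], ?_⟩
  have := congrArg f hx.2
  simpa using this

theorem commute (hx : HasType x τ) (h : τ.2 = 1) : Commute x H.fibre := by
  have := hx.2
  rw [h, Units.val_one, zpow_one, mul_inv_eq_iff_eq_mul] at this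
  exact this

theorem of_commute (h : Commute x H.fibre) : HasType x (H.deg x, 1) :=
  ⟨rfl, by rw [h.eq]; simp⟩

end HasType

end FibredGroup

open FibredGroup

/-- A block: a functor `Sol` from fibred groups to types with a natural map `val` to the
underlying group, whose values commute with the fibre. The typical example consists of all tuples
that satisfy some relations, with the value of a word. -/
structure Block where
  Sol : FibredGroup → Type
  map : ∀ {H K : FibredGroup}, Hom H K → Sol H → Sol K
  map_id : ∀ {H : FibredGroup} (x : Sol H), map (Hom.id H) x = x
  map_comp : ∀ {H K L : FibredGroup} (g : Hom K L) (f : Hom H K) (x : Sol H),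
    map (g.comp f) x = map g (map f x)
  val : ∀ {H : FibredGroup}, Sol H → H
  val_map : ∀ {H K : FibredGroup} (f : Hom H K) (x : Sol H), val (map f x) = f (val x)
  val_comm : ∀ {H : FibredGroup} (x : Sol H), Commute (val x) H.fibre

namespace Block

attribute [simp] map_id val_map

/-- Natural bijections that preserve the values. -/
structure Iso (A B : Block) where
  toFun : ∀ {H : FibredGroup}, A.Sol H → B.Sol H
  invFun : ∀ {H : FibredGroup}, B.Sol H → A.Sol H
  left_inv : ∀ {H : FibredGroup} (x : A.Sol H), invFun (toFun x) = x
  right_inv : ∀ {H : FibredGroup} (y : B.Sol H), toFun (invFun y) = y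
  map_toFun : ∀ {H K : FibredGroup} (f : Hom H K) (x : A.Sol H),
    toFun (A.map f x) = B.map f (toFun x)
  val_toFun : ∀ {H : FibredGroup} (x : A.Sol H), B.val (toFun x) = A.val x

attribute [simp] Iso.left_inv Iso.right_inv Iso.val_toFun

namespace Iso

/-- The identity. -/
def refl (A : Block) : Iso A A where
  toFun x := x
  invFun x := x
  left_inv _ := rfl
  right_inv _ := rfl
  map_toFun _ _ := rfl
  val_toFun _ := rfl

/-- The inverse. -/
def symm {A B : Block} (e : Iso A B) : Iso B A where
  toFun := e.invFun
  invFun := e.toFun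
  left_inv := e.right_inv
  right_inv := e.left_inv
  map_toFun f x := by
    rw [← e.left_inv (A.map f _), e.map_toFun, e.right_inv]
  val_toFun x := by rw [← e.val_toFun, e.right_inv]

/-- Composition. -/
def trans {A B C : Block} (e : Iso A B) (e' : Iso B C) : Iso A C where
  toFun x := e'.toFun (e.toFun x)
  invFun x := e.invFun (e'.invFun x)
  left_inv := by simp
  right_inv := by simp
  map_toFun f x := by rw [e.map_toFun, e'.map_toFun]
  val_toFun := by simp

end Iso

/-- The empty block. -/
def one : Block where
  Sol _ := Unit
  map _ x := x
  map_id _ := rfl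
  map_comp _ _ _ := rfl
  val _ := 1
  val_map f _ := (map_one f).symm
  val_comm _ := Commute.one_left _

/-- Juxtaposition of two blocks: the values are multiplied. -/
def tensor (A B : Block) : Block where
  Sol H := A.Sol H × B.Sol H
  map f x := (A.map f x.1, B.map f x.2)
  map_id x := by simp
  map_comp g f x := by simp [A.map_comp, B.map_comp]
  val x := A.val x.1 * B.val x.2
  val_map f x := by simp
  val_comm x := (A.val_comm x.1).mul_left (B.val_comm x.2)

namespace Iso

/-- Juxtaposition of isomorphisms. -/
def tensor {A A' B B' : Block} (e : Iso A A') (e' : Iso B B') :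
    Iso (A.tensor B) (A'.tensor B') where
  toFun x := (e.toFun x.1, e'.toFun x.2)
  invFun x := (e.invFun x.1, e'.invFun x.2)
  left_inv x := Prod.ext (e.left_inv x.1) (e'.left_inv x.2)
  right_inv x := Prod.ext (e.right_inv x.1) (e'.right_inv x.2)
  map_toFun f x := Prod.ext (e.map_toFun f x.1) (e'.map_toFun f x.2)
  val_toFun x := congrArg₂ (· * ·) (e.val_toFun x.1) (e'.val_toFun x.2)

/-- Juxtaposition is associative. -/
def assoc (A B C : Block) : Iso ((A.tensor B).tensor C) (A.tensor (B.tensor C)) where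
  toFun x := (x.1.1, x.1.2, x.2)
  invFun x := ((x.1, x.2.1), x.2.2)
  left_inv _ := rfl
  right_inv _ := rfl
  map_toFun _ _ := rfl
  val_toFun x := (mul_assoc (A.val x.1.1) (B.val x.1.2) (C.val x.2)).symm

/-- The empty block is a left unit. -/
def oneTensor (A : Block) : Iso (one.tensor A) A where
  toFun x := x.2
  invFun x := ((), x)
  left_inv _ := rfl
  right_inv _ := rfl
  map_toFun _ _ := rfl
  val_toFun x := (one_mul (A.val x.2)).symm

theorem map_conj_conj (A : Block) {H : FibredGroup} (g : H) (hg : Commute g H.fibre)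
    (g' : H) (hg' : Commute g' H.fibre) (h : g * g' = 1) (x : A.Sol H) :
    A.map (Hom.conj g hg) (A.map (Hom.conj g' hg') x) = x := by
  rw [← A.map_comp]
  convert A.map_id x
  ext y
  obtain rfl := eq_inv_of_mul_eq_one_right h
  simp [mul_assoc]

/-- Two neighbouring blocks can be interchanged: `x y = (x y x⁻¹) x`, and conjugation by `x`
respects the relations of the second block since it fixes the fibre. -/
def swap (A B : Block) : Iso (A.tensor B) (B.tensor A) where
  toFun x := (B.map (Hom.conj (A.val x.1) (A.val_comm x.1)) x.2, x.1)
  invFun x := (x.2, B.map (Hom.conj (A.val x.2)⁻¹ (A.val_comm x.2).inv_left) x.1)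
  left_inv x := Prod.ext rfl (map_conj_conj _ _ _ _ _ (by simp) _)
  right_inv x := Prod.ext (map_conj_conj _ _ _ _ _ (by simp) _) rfl
  map_toFun f x := by
    refine Prod.ext ?_ rfl
    change B.map _ (B.map f x.2) = B.map f (B.map _ x.2)
    rw [← B.map_comp, ← B.map_comp]
    congr 1
    ext y
    change A.val (A.map f x.1) * f y * (A.val (A.map f x.1))⁻¹ = _
    simp
  val_toFun x := by
    change B.val (B.map _ x.2) * A.val x.1 = A.val x.1 * B.val x.2
    simp

end Iso

instance setoid : Setoid Block where
  r A B := Nonempty (Iso A B)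
  iseqv := ⟨fun A => ⟨Iso.refl A⟩, fun ⟨e⟩ => ⟨e.symm⟩, fun ⟨e⟩ ⟨e'⟩ => ⟨e.trans e'⟩⟩

end Block

/-- Isomorphism classes of blocks. Juxtaposition makes them a commutative monoid. -/
def BlockClass : Type 1 := Quotient Block.setoid

/-- The isomorphism class of a block. -/
def Block.cls (A : Block) : BlockClass := Quotient.mk _ A

theorem Block.cls_eq_iff {A B : Block} : A.cls = B.cls ↔ Nonempty (Block.Iso A B) :=
  Quotient.eq

theorem Block.Iso.cls_eq {A B : Block} (e : Block.Iso A B) : A.cls = B.cls :=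
  Block.cls_eq_iff.2 ⟨e⟩

instance : CommMonoid BlockClass where
  mul := Quotient.map₂ Block.tensor fun _ _ ⟨e⟩ _ _ ⟨e'⟩ => ⟨e.tensor e'⟩
  one := Block.one.cls
  mul_assoc := by
    rintro ⟨A⟩ ⟨B⟩ ⟨C⟩
    exact (Block.Iso.assoc A B C).cls_eq
  one_mul := by
    rintro ⟨A⟩
    exact (Block.Iso.oneTensor A).cls_eq
  mul_one := by
    rintro ⟨A⟩
    exact ((Block.Iso.swap A Block.one).trans (Block.Iso.oneTensor A)).cls_eq
  mul_comm := by
    rintro ⟨A⟩ ⟨B⟩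
    exact (Block.Iso.swap A B).cls_eq

namespace Block

theorem cls_tensor (A B : Block) : (A.tensor B).cls = A.cls * B.cls := rfl

/-- Juxtaposition of a list of blocks. -/
def list (l : List Block) : Block := l.foldr tensor one

theorem cls_list (l : List Block) : (list l).cls = (l.map cls).prod := by
  induction l with
  | nil => rfl
  | cons A l ih => rw [List.map_cons, List.prod_cons, ← ih]; rfl

/-- Juxtaposition of a finite family of blocks. -/
def pi {n : ℕ} (A : Fin n → Block) : Block where
  Sol H := ∀ i, (A i).Sol H
  map f x i := (A i).map f (x i)
  map_id x := by simp
  map_comp g f x := by simp [map_comp]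
  val x := (List.ofFn fun i => (A i).val (x i)).prod
  val_map f x := by simp [map_list_prod, List.map_ofFn, Function.comp_def]
  val_comm {H} x := by
    apply Commute.list_prod_left
    intro y hy
    obtain ⟨i, rfl⟩ := List.mem_ofFn.1 hy
    exact (A i).val_comm _

/-- The first block of a finite family can be split off. -/
def piSucc {n : ℕ} (A : Fin (n + 1) → Block) :
    Iso (pi A) ((A 0).tensor (pi fun i => A i.succ)) where
  toFun x := (x 0, fun i => x i.succ)
  invFun x := Fin.cons x.1 x.2
  left_inv x := Fin.cons_self_tail x
  right_inv _ := rfl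
  map_toFun _ _ := rfl
  val_toFun x := by
    change _ * (List.ofFn _).prod = (List.ofFn _).prod
    rw [List.ofFn_succ, List.prod_cons]

theorem cls_pi {n : ℕ} (A : Fin n → Block) : (pi A).cls = (List.ofFn fun i => (A i).cls).prod := by
  induction n with
  | zero =>
    refine Iso.cls_eq (B := one) ⟨fun _ => (), fun _ i => i.elim0, ?_, ?_, ?_, ?_⟩
    · intro H x
      funext i
      exact i.elim0
    · intro _ _; rfl
    · intros; rfl
    · intros; rfl
  | succ n ih =>
    rw [(piSucc A).cls_eq, cls_tensor, ih, List.ofFn_succ, List.prod_cons]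

end Block

/-! ### The elementary blocks and their relations -/

namespace FibredGroup.HasType

variable {H : FibredGroup} {x y : H} {τ σ : ElementType}

theorem conj (hx : HasType x τ) (hy : HasType y σ) : HasType (x * y * x⁻¹) σ :=
  ((hx.mul hy).mul hx.inv).congr (by rw [mul_comm τ σ, mul_assoc, τ.mul_self, mul_one])

theorem commutator (hx : HasType x τ) (hy : HasType y σ) : HasType (x * y * x⁻¹ * y⁻¹) 1 :=
  ((hx.conj hy).mul hy.inv).congr σ.mul_self

theorem sq (hx : HasType x τ) : HasType (x ^ 2) 1 := by
  rw [pow_two]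
  exact (hx.mul hx).congr τ.mul_self

/-- Conjugation by `g` turns the fibre relation `x ^ a h ^ b = 1` into `x ^ a h ^ (± b) = 1`. -/
theorem conj_rel {g : H} (hg : HasType g τ) {a b : ℤ} (hx : x ^ a * H.fibre ^ b = 1) :
    (g * x * g⁻¹) ^ a * H.fibre ^ ((τ.2 : ℤ) * b) = 1 := by
  rw [_root_.conj_zpow, ← hg.conj_fibre_zpow]
  calc g * x ^ a * g⁻¹ * (g * H.fibre ^ b * g⁻¹) = g * (x ^ a * H.fibre ^ b) * g⁻¹ := by group
    _ = 1 := by rw [hx]; group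

theorem conj_rel_of_eq_one {g : H} (hg : HasType g τ) (hτ : τ.2 = 1) {a b : ℤ}
    (hx : x ^ a * H.fibre ^ b = 1) : (g * x * g⁻¹) ^ a * H.fibre ^ b = 1 := by
  have := hg.conj_rel hx
  rwa [hτ, Units.val_one, one_mul] at this

end FibredGroup.HasType

namespace Block

/-- An exceptional fibre: an element `s` of degree `d` that commutes with the fibre `h` and
satisfies `s ^ a h ^ b = 1`. -/
def coneBlock (d : Multiplicative (ZMod 2)) (a b : ℤ) : Block where
  Sol H := {x : H // HasType x (d, 1) ∧ x ^ a * H.fibre ^ b = 1}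
  map f x := ⟨f x.1, x.2.1.map f, by simpa using congrArg f x.2.2⟩
  map_id _ := rfl
  map_comp _ _ _ := rfl
  val x := x.1
  val_map _ _ := rfl
  val_comm x := x.2.1.commute rfl

/-- A handle: two elements `x`, `y` of types `τ`, `σ`, with value `[x, y]`. -/
def handle (τ σ : ElementType) : Block where
  Sol H := {x : H × H // HasType x.1 τ ∧ HasType x.2 σ}
  map f x := ⟨(f x.1.1, f x.1.2), x.2.1.map f, x.2.2.map f⟩
  map_id _ := rfl
  map_comp _ _ _ := rfl
  val x := x.1.1 * x.1.2 * x.1.1⁻¹ * x.1.2⁻¹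
  val_map f x := by simp
  val_comm x := (x.2.1.commutator x.2.2).commute rfl

/-- A cross-cap: an element `x` of type `τ`, with value `x²`. -/
def crosscap (τ : ElementType) : Block where
  Sol H := {x : H // HasType x τ}
  map f x := ⟨f x.1, x.2.map f⟩
  map_id _ := rfl
  map_comp _ _ _ := rfl
  val x := x.1 ^ 2
  val_map f x := by simp
  val_comm x := x.2.sq.commute rfl

/-- The block without generators whose value is a power of the fibre. -/
def euler (e : ℤ) : Block where
  Sol _ := Unit
  map _ x := x
  map_id _ := rfl
  map_comp _ _ _ := rfl
  val {H} _ := H.fibre ^ e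
  val_map f _ := by simp
  val_comm _ := (Commute.refl _).zpow_left _

theorem cls_euler_add (e e' : ℤ) : (euler (e + e')).cls = (euler e).cls * (euler e').cls :=
  Iso.cls_eq (B := (euler e).tensor (euler e'))
    { toFun _ := ((), ())
      invFun _ := ()
      left_inv _ := rfl
      right_inv _ := rfl
      map_toFun _ _ := rfl
      val_toFun {H} _ := (zpow_add H.fibre e e').symm }

theorem cls_euler_zero : (euler 0).cls = 1 :=
  Iso.cls_eq (B := one)
    { toFun _ := ()
      invFun _ := ()
      left_inv _ := rfl
      right_inv _ := rfl
      map_toFun _ _ := rfl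
      val_toFun {H} _ := (zpow_zero H.fibre).symm }

/-- `[x, y] = [x y x⁻¹, x⁻¹]`. -/
theorem cls_handle_comm (τ σ : ElementType) : (handle τ σ).cls = (handle σ τ).cls :=
  Iso.cls_eq
    { toFun x := ⟨(x.1.1 * x.1.2 * x.1.1⁻¹, x.1.1⁻¹), x.2.1.conj x.2.2, x.2.1.inv⟩
      invFun x := ⟨(x.1.2⁻¹, x.1.2 * x.1.1 * x.1.2⁻¹), x.2.2.inv, x.2.2.conj x.2.1⟩
      left_inv x := Subtype.ext (Prod.ext (by simp) (by dsimp only; group))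
      right_inv x := Subtype.ext (Prod.ext (by dsimp only; group) (by simp))
      map_toFun f x := Subtype.ext (Prod.ext (by simp [handle]) (by simp [handle]))
      val_toFun x := by simp only [handle]; group }

/-- `[x, y] = [x y, y]`. -/
theorem cls_handle_mul (τ σ : ElementType) : (handle τ σ).cls = (handle (τ * σ) σ).cls :=
  Iso.cls_eq
    { toFun x := ⟨(x.1.1 * x.1.2, x.1.2), x.2.1.mul x.2.2, x.2.2⟩
      invFun x := ⟨(x.1.1 * x.1.2⁻¹, x.1.2),
        (x.2.1.mul x.2.2.inv).congr (by rw [mul_assoc, σ.mul_self, mul_one]), x.2.2⟩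
      left_inv x := Subtype.ext (Prod.ext (by simp) (by simp))
      right_inv x := Subtype.ext (Prod.ext (by simp) (by simp))
      map_toFun f x := Subtype.ext (Prod.ext (by simp [handle]) (by simp [handle]))
      val_toFun x := by simp only [handle]; group }

/-- The effect of a Dehn twist along a curve that runs through two handles: with `γ = b⁻¹ c`,
`[a, b] [c, d] = [a γ⁻¹, γ b γ⁻¹] [γ b, d γ⁻¹]`. -/
theorem cls_handle_mul_handle (τ₁ τ₂ τ₃ τ₄ : ElementType) :
    (handle τ₁ τ₂).cls * (handle τ₃ τ₄).cls =
      (handle (τ₁ * (τ₂ * τ₃)) τ₂).cls * (handle τ₃ (τ₄ * (τ₂ * τ₃))).cls :=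
  Iso.cls_eq (A := (handle τ₁ τ₂).tensor (handle τ₃ τ₄))
    (B := (handle (τ₁ * (τ₂ * τ₃)) τ₂).tensor (handle τ₃ (τ₄ * (τ₂ * τ₃))))
    { toFun := fun ⟨⟨(a, b), hab⟩, ⟨(c, d), hcd⟩⟩ =>
        have hγ : HasType (b⁻¹ * c) (τ₂ * τ₃) := hab.2.inv.mul hcd.1
        (⟨(a * (b⁻¹ * c)⁻¹, (b⁻¹ * c) * b * (b⁻¹ * c)⁻¹), hab.1.mul hγ.inv, hγ.conj hab.2⟩,
          ⟨((b⁻¹ * c) * b, d * (b⁻¹ * c)⁻¹),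
            (hγ.mul hab.2).congr (by
              rw [mul_comm τ₂ τ₃, mul_assoc, τ₂.mul_self, mul_one]), hcd.2.mul hγ.inv⟩)
      invFun := fun ⟨⟨(a, b), hab⟩, ⟨(c, d), hcd⟩⟩ =>
        have hγ : HasType (b⁻¹ * c) (τ₂ * τ₃) := hab.2.inv.mul hcd.1
        (⟨(a * (b⁻¹ * c), (b⁻¹ * c)⁻¹ * b * (b⁻¹ * c)),
            (hab.1.mul hγ).congr (by rw [mul_assoc, (τ₂ * τ₃).mul_self, mul_one]), by
              simpa using hγ.inv.conj hab.2⟩,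
          ⟨((b⁻¹ * c)⁻¹ * b * (b⁻¹ * c) * (b⁻¹ * c), d * (b⁻¹ * c)), by
            refine HasType.congr (σ := τ₃) ((((hγ.inv.mul hab.2)).mul hγ).mul hγ) ?_
            rw [mul_assoc, (τ₂ * τ₃).mul_self, mul_comm, one_mul, mul_comm τ₂ τ₃, mul_assoc,
              τ₂.mul_self, mul_one],
            (hcd.2.mul hγ).congr (by rw [mul_assoc, (τ₂ * τ₃).mul_self, mul_one])⟩)
      left_inv := fun ⟨⟨(a, b), hab⟩, ⟨(c, d), hcd⟩⟩ => by
        refine Prod.ext (Subtype.ext (Prod.ext ?_ ?_)) (Subtype.ext (Prod.ext ?_ ?_)) <;>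
          dsimp only <;> group
      right_inv := fun ⟨⟨(a, b), hab⟩, ⟨(c, d), hcd⟩⟩ => by
        refine Prod.ext (Subtype.ext (Prod.ext ?_ ?_)) (Subtype.ext (Prod.ext ?_ ?_)) <;>
          dsimp only <;> group
      map_toFun := fun f ⟨⟨(a, b), hab⟩, ⟨(c, d), hcd⟩⟩ => by
        refine Prod.ext (Subtype.ext (Prod.ext ?_ ?_)) (Subtype.ext (Prod.ext ?_ ?_)) <;>
          simp [handle, tensor]
      val_toFun := fun ⟨⟨(a, b), hab⟩, ⟨(c, d), hcd⟩⟩ => by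
        simp only [handle, tensor]
        group }

/-- A handle next to a cross-cap can be replaced by two cross-caps: with `u = b a⁻¹ b⁻¹ x`,
`t = b⁻¹ u⁻¹` and `s = a u b`, one has `[a, b] x² = s² (t² u²)`. -/
theorem cls_handle_mul_crosscap (τ : ElementType) :
    (handle 1 1).cls * (crosscap τ).cls =
      (crosscap τ).cls * ((crosscap τ).cls * (crosscap τ).cls) :=
  Iso.cls_eq (A := (handle 1 1).tensor (crosscap τ))
    (B := (crosscap τ).tensor ((crosscap τ).tensor (crosscap τ)))
    { toFun := fun ⟨⟨(a, b), hab⟩, ⟨x, hx⟩⟩ =>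
        have hu : HasType (b * a⁻¹ * b⁻¹ * x) τ :=
          ((hab.2.conj hab.1.inv).mul hx).congr (one_mul τ)
        (⟨a * (b * a⁻¹ * b⁻¹ * x) * b, ((hab.1.mul hu).mul hab.2).congr (by simp)⟩,
          ⟨b⁻¹ * (b * a⁻¹ * b⁻¹ * x)⁻¹, (hab.2.inv.mul hu.inv).congr (one_mul τ)⟩,
          ⟨b * a⁻¹ * b⁻¹ * x, hu⟩)
      invFun := fun ⟨⟨s, hs⟩, ⟨t, ht⟩, ⟨u, hu⟩⟩ =>
        have hb : HasType (u⁻¹ * t⁻¹) 1 := (hu.inv.mul ht.inv).congr τ.mul_self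
        have ha : HasType (s * t) 1 := (hs.mul ht).congr τ.mul_self
        (⟨(s * t, u⁻¹ * t⁻¹), ha, hb⟩,
          ⟨(u⁻¹ * t⁻¹) * (s * t) * (u⁻¹ * t⁻¹)⁻¹ * u,
            ((hb.conj ha).mul hu).congr (one_mul τ)⟩)
      left_inv := fun ⟨⟨(a, b), hab⟩, ⟨x, hx⟩⟩ => by
        refine Prod.ext (Subtype.ext (Prod.ext ?_ ?_)) (Subtype.ext ?_) <;>
          dsimp only <;> group
      right_inv := fun ⟨⟨s, hs⟩, ⟨t, ht⟩, ⟨u, hu⟩⟩ => by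
        refine Prod.ext (Subtype.ext ?_) (Prod.ext (Subtype.ext ?_) (Subtype.ext ?_)) <;>
          dsimp only <;> group
      map_toFun := fun f ⟨⟨(a, b), hab⟩, ⟨x, hx⟩⟩ => by
        refine Prod.ext (Subtype.ext ?_) (Prod.ext (Subtype.ext ?_) (Subtype.ext ?_)) <;>
          simp [handle, crosscap, tensor]
      val_toFun := fun ⟨⟨(a, b), hab⟩, ⟨x, hx⟩⟩ => by
        simp only [handle, tensor, crosscap, pow_two]
        group }

/-- Sliding an exceptional fibre over a handle: `s [x, y] = [s x, y] (y s y⁻¹)`. -/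
theorem cls_coneBlock_mul_handle (d : Multiplicative (ZMod 2)) (a b : ℤ) (τ σ : ElementType) :
    (coneBlock d a b).cls * (handle τ σ).cls =
      (handle ((d, 1) * τ) σ).cls * (coneBlock d a (σ.2 * b)).cls :=
  Iso.cls_eq (A := (coneBlock d a b).tensor (handle τ σ))
    (B := (handle ((d, 1) * τ) σ).tensor (coneBlock d a (σ.2 * b)))
    { toFun := fun ⟨⟨s, hs⟩, ⟨(x, y), hxy⟩⟩ =>
        (⟨(s * x, y), hs.1.mul hxy.1, hxy.2⟩, ⟨y * s * y⁻¹, hxy.2.conj hs.1, hxy.2.conj_rel hs.2⟩)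
      invFun := fun ⟨⟨(x, y), hxy⟩, ⟨s, hs⟩⟩ =>
        have hs₁ : HasType (y⁻¹ * s * y) (d, 1) := by simpa using hxy.2.inv.conj hs.1
        (⟨y⁻¹ * s * y, hs₁, by
            have := hxy.2.inv.conj_rel hs.2
            rwa [← mul_assoc, ← Units.val_mul, Int.units_mul_self, Units.val_one, one_mul,
              inv_inv] at this⟩,
          ⟨((y⁻¹ * s * y)⁻¹ * x, y),
            (hs₁.inv.mul hxy.1).congr (ElementType.mul_self_cancel _ _), hxy.2⟩)
      left_inv := fun ⟨⟨s, hs⟩, ⟨(x, y), hxy⟩⟩ => by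
        refine Prod.ext (Subtype.ext ?_) (Subtype.ext (Prod.ext ?_ ?_)) <;>
          dsimp only <;> group
      right_inv := fun ⟨⟨(x, y), hxy⟩, ⟨s, hs⟩⟩ => by
        refine Prod.ext (Subtype.ext (Prod.ext ?_ ?_)) (Subtype.ext ?_) <;>
          dsimp only <;> group
      map_toFun := fun f ⟨⟨s, hs⟩, ⟨(x, y), hxy⟩⟩ => by
        refine Prod.ext (Subtype.ext (Prod.ext ?_ ?_)) (Subtype.ext ?_) <;>
          simp [handle, coneBlock, tensor]
      val_toFun := fun ⟨⟨s, hs⟩, ⟨(x, y), hxy⟩⟩ => by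
        simp only [handle, tensor, coneBlock]
        group }

/-- Sliding an exceptional fibre over a cross-cap: `x² s = z² w` with `z = x² s x⁻¹` and
`w = x s⁻¹ x⁻¹`. -/
theorem cls_coneBlock_mul_crosscap (d : Multiplicative (ZMod 2)) (a b : ℤ) (τ : ElementType) :
    (coneBlock d a b).cls * (crosscap τ).cls =
      (crosscap ((d, 1) * τ)).cls * (coneBlock d a (-(τ.2 * b))).cls := by
  rw [mul_comm]
  have key : ∀ {H : FibredGroup} {s x : H} {c : ℤ} {σ : ElementType}, HasType x σ →
      s ^ a * H.fibre ^ c = 1 →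
      (x * s⁻¹ * x⁻¹) ^ a * H.fibre ^ (-(σ.2 * c)) = 1 := by
    intro H s x c σ hx hs
    have h : s⁻¹ ^ a * H.fibre ^ (-c) = 1 := by
      rw [inv_zpow, zpow_neg, ← mul_inv_rev, inv_eq_one]
      exact mul_eq_one_comm.1 hs
    simpa using hx.conj_rel h
  exact Iso.cls_eq (A := (crosscap τ).tensor (coneBlock d a b))
    (B := (crosscap ((d, 1) * τ)).tensor (coneBlock d a (-(τ.2 * b))))
    { toFun := fun ⟨⟨x, hx⟩, ⟨s, hs⟩⟩ =>
        (⟨x * (x * s * x⁻¹), (hx.mul (hx.conj hs.1)).congr (mul_comm _ _)⟩,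
          ⟨x * s⁻¹ * x⁻¹, hx.conj hs.1.inv, key hx hs.2⟩)
      invFun := fun ⟨⟨z, hz⟩, ⟨w, hw⟩⟩ =>
        have hx : HasType (z * w) τ :=
          (hz.mul hw.1).congr (by rw [mul_comm, ElementType.mul_self_cancel])
        (⟨z * w, hx⟩, ⟨(z * w)⁻¹ * w⁻¹ * (z * w), by simpa using hx.inv.conj hw.1.inv, by
          have := key hx.inv hw.2
          rwa [mul_neg, neg_neg, ← mul_assoc, ← Units.val_mul, Int.units_mul_self, Units.val_one,
            one_mul, inv_inv] at this⟩)
      left_inv := fun ⟨⟨x, hx⟩, ⟨s, hs⟩⟩ => by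
        refine Prod.ext (Subtype.ext ?_) (Subtype.ext ?_) <;> dsimp only <;> group
      right_inv := fun ⟨⟨z, hz⟩, ⟨w, hw⟩⟩ => by
        refine Prod.ext (Subtype.ext ?_) (Subtype.ext ?_) <;> dsimp only <;> group
      map_toFun := fun f ⟨⟨x, hx⟩, ⟨s, hs⟩⟩ => by
        refine Prod.ext (Subtype.ext ?_) (Subtype.ext ?_) <;>
          simp [crosscap, coneBlock, tensor]
      val_toFun := fun ⟨⟨x, hx⟩, ⟨s, hs⟩⟩ => by
        simp only [crosscap, tensor, coneBlock, pow_two]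
        group }

/-- Replacing `x` by `x h` in a cross-cap whose core commutes with the fibre. -/
theorem cls_euler_two_mul_crosscap (τ : ElementType) (hτ : τ.2 = 1) :
    (euler 2).cls * (crosscap τ).cls = (crosscap τ).cls :=
  Iso.cls_eq (A := (euler 2).tensor (crosscap τ))
    { toFun := fun {H} ⟨_, ⟨x, hx⟩⟩ => ⟨x * H.fibre, (hx.mul HasType.fibre).congr (mul_one τ)⟩
      invFun := fun {H} ⟨x, hx⟩ =>
        ((), ⟨x * H.fibre⁻¹, (hx.mul HasType.fibre.inv).congr (mul_one τ)⟩)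
      left_inv := fun ⟨_, ⟨x, hx⟩⟩ => Prod.ext rfl (Subtype.ext (by simp))
      right_inv := fun ⟨x, hx⟩ => Subtype.ext (by simp)
      map_toFun := fun f ⟨_, ⟨x, hx⟩⟩ => Subtype.ext (by simp [crosscap, tensor])
      val_toFun := fun {H} ⟨_, ⟨x, hx⟩⟩ => by
        have h := hx.commute hτ
        simp only [crosscap, tensor, euler]
        rw [h.mul_pow, ← zpow_natCast H.fibre]
        exact ((h.pow_left 2).zpow_right 2).eq }

/-- Replacing `x` by `x h` in a handle whose second core curve inverts the fibre. -/
theorem cls_euler_two_mul_handle (τ σ : ElementType) (hσ : σ.2 = -1) :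
    (euler 2).cls * (handle τ σ).cls = (handle τ σ).cls := by
  have key : (euler (τ.2 * 2)).cls * (handle τ σ).cls = (handle τ σ).cls :=
    Iso.cls_eq (A := (euler (τ.2 * 2)).tensor (handle τ σ))
      { toFun := fun {H} ⟨_, ⟨(x, y), hxy⟩⟩ =>
          ⟨(x * H.fibre, y), (hxy.1.mul HasType.fibre).congr (mul_one τ), hxy.2⟩
        invFun := fun {H} ⟨(x, y), hxy⟩ =>
          ((), ⟨(x * H.fibre⁻¹, y), (hxy.1.mul HasType.fibre.inv).congr (mul_one τ), hxy.2⟩)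
        left_inv := fun ⟨_, ⟨(x, y), hxy⟩⟩ =>
          Prod.ext rfl (Subtype.ext (Prod.ext (by simp) rfl))
        right_inv := fun ⟨(x, y), hxy⟩ => Subtype.ext (Prod.ext (by simp) rfl)
        map_toFun := fun f ⟨_, ⟨(x, y), hxy⟩⟩ =>
          Subtype.ext (Prod.ext (by simp [handle, tensor]) rfl)
        val_toFun := fun {H} ⟨_, ⟨(x, y), hxy⟩⟩ => by
          simp only [handle, tensor, euler]
          have h₁ : y * H.fibre⁻¹ * y⁻¹ = H.fibre := by
            have := hxy.2.conj_fibre_zpow (-1)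
            rwa [hσ, zpow_neg_one, Units.val_neg, Units.val_one, neg_mul_neg, one_mul,
              zpow_one] at this
          calc x * H.fibre * y * (x * H.fibre)⁻¹ * y⁻¹
              = x * H.fibre * (y * H.fibre⁻¹ * y⁻¹) * x⁻¹ * (x * y * x⁻¹ * y⁻¹) := by group
            _ = (x * H.fibre ^ (2 : ℤ) * x⁻¹) * (x * y * x⁻¹ * y⁻¹) := by
                rw [h₁, zpow_two]; group
            _ = _ := by rw [hxy.1.conj_fibre_zpow] }
  rcases Int.units_eq_one_or τ.2 with h | h
  · rwa [h, Units.val_one, one_mul] at key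
  · rw [h] at key
    -- Here the substitution gives `h⁻²`, which is cancelled by multiplying with `h²`.
    conv_lhs => rw [← key, ← mul_assoc, ← cls_euler_add]
    simp [cls_euler_zero]

end Block

/-! ### Groups presented by blocks -/

namespace Block

/-- The fibred group `G` is presented by the block `A`, with generators `x`: it is universal among
the fibred groups with a solution of value `1`. -/
structure Presents (A : Block) (G : FibredGroup) (x : A.Sol G) : Prop where
  val_eq_one : A.val x = 1
  exists_hom : ∀ {H : FibredGroup} (y : A.Sol H), A.val y = 1 → ∃ f : Hom G H, A.map f x = y
  hom_ext : ∀ {H : FibredGroup} (f f' : Hom G H), A.map f x = A.map f' x → f = f'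

theorem Presents.of_cls_eq {A B : Block} {G : FibredGroup} {x : A.Sol G} (hx : A.Presents G x)
    (h : A.cls = B.cls) : ∃ y : B.Sol G, B.Presents G y := by
  obtain ⟨e⟩ := cls_eq_iff.1 h
  refine ⟨e.toFun x, by rw [e.val_toFun, hx.val_eq_one], fun {H} y hy => ?_, fun f f' hf => ?_⟩
  · obtain ⟨f, hf⟩ := hx.exists_hom (e.invFun y) (by
      rw [← e.val_toFun, e.right_inv, hy])
    exact ⟨f, by rw [← e.map_toFun, hf, e.right_inv]⟩
  · apply hx.hom_ext
    rw [← e.map_toFun, ← e.map_toFun] at hf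
    rw [← e.left_inv (A.map f x), hf, e.left_inv]

end Block

namespace SeifertType

/-- The sign `ε_j` as a unit. -/
def signUnit (t : SeifertType) (j : ℕ) : ℤˣ := if t.sign j = 1 then 1 else -1

theorem coe_signUnit (t : SeifertType) (j : ℕ) : (t.signUnit j : ℤ) = t.sign j := by
  unfold signUnit
  split_ifs with h
  · rw [h, Units.val_one]
  · cases t <;> simp_all [sign]

theorem map_commutatorProd {G H F : Type*} [Group G] [Group H] [FunLike F G H]
    [MonoidHomClass F G H] (f : F) (g : ℕ) (v : Fin (2 * g) → G) :
    f (commutatorProd g v) = commutatorProd g fun j => f (v j) := by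
  simp [commutatorProd, commutator, map_list_prod, List.map_ofFn, Function.comp_def]

theorem map_squareProd {G H F : Type*} [Group G] [Group H] [FunLike F G H]
    [MonoidHomClass F G H] (f : F) (g : ℕ) (v : Fin g → G) :
    f (squareProd g v) = squareProd g fun j => f (v j) := by
  simp [squareProd, map_list_prod, List.map_ofFn, Function.comp_def]

theorem map_surfaceWord {G H F : Type*} [Group G] [Group H] [FunLike F G H]
    [MonoidHomClass F G H] (f : F) (t : SeifertType) (g : ℕ) (v : Fin (t.numV g) → G) :
    f (t.surfaceWord g v) = t.surfaceWord g fun j => f (v j) := by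
  cases t <;> first | exact map_commutatorProd f g v | exact map_squareProd f g v

theorem commute_commutatorProd {H : FibredGroup} {g : ℕ} {v : Fin (2 * g) → H}
    {τ : Fin (2 * g) → ElementType} (hv : ∀ j, HasType (v j) (τ j)) :
    Commute (commutatorProd g v) H.fibre := by
  apply Commute.list_prod_left
  intro y hy
  obtain ⟨i, rfl⟩ := List.mem_ofFn.1 hy
  exact ((hv _).commutator (hv _)).commute rfl

theorem commute_squareProd {H : FibredGroup} {g : ℕ} {v : Fin g → H}
    {τ : Fin g → ElementType} (hv : ∀ j, HasType (v j) (τ j)) :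
    Commute (squareProd g v) H.fibre := by
  apply Commute.list_prod_left
  intro y hy
  obtain ⟨i, rfl⟩ := List.mem_ofFn.1 hy
  exact (hv _).sq.commute rfl

theorem commute_surfaceWord {H : FibredGroup} {t : SeifertType} {g : ℕ}
    {v : Fin (t.numV g) → H} {τ : Fin (t.numV g) → ElementType}
    (hv : ∀ j, HasType (v j) (τ j)) : Commute (t.surfaceWord g v) H.fibre := by
  cases t <;> first | exact commute_commutatorProd hv | exact commute_squareProd hv

end SeifertType

namespace Block

/-- The block of the underlying surface: elements `v_j` of the given types, with the surface word
as value. -/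
def surface (t : SeifertType) (g : ℕ) (τ : Fin (t.numV g) → ElementType) : Block where
  Sol H := {v : Fin (t.numV g) → H // ∀ j, HasType (v j) (τ j)}
  map f v := ⟨fun j => f (v.1 j), fun j => (v.2 j).map f⟩
  map_id _ := rfl
  map_comp _ _ _ := rfl
  val v := t.surfaceWord g v.1
  val_map f v := (SeifertType.map_surfaceWord f t g v.1).symm
  val_comm v := SeifertType.commute_surfaceWord v.2

theorem cls_surface_o1 (g : ℕ) (τ : Fin (2 * g) → ElementType) :
    (surface .o1 g τ).cls =
      (List.ofFn fun i : Fin g =>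
        (handle (τ ⟨2 * i.val, by omega⟩) (τ ⟨2 * i.val + 1, by omega⟩)).cls).prod := by
  rw [← cls_pi fun i : Fin g => handle (τ ⟨2 * i.val, by omega⟩) (τ ⟨2 * i.val + 1, by omega⟩)]
  refine Iso.cls_eq
    { toFun := fun {H} v i => ⟨(v.1 ⟨2 * i.val, by change _ < 2 * g; omega⟩,
        v.1 ⟨2 * i.val + 1, by change _ < 2 * g; omega⟩), v.2 _, v.2 _⟩
      invFun := fun {H} x => ⟨fun j : Fin (2 * g) => if j.val % 2 = 0
        then (x ⟨j.val / 2, by omega⟩).1.1 else (x ⟨j.val / 2, by omega⟩).1.2, ?_⟩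
      left_inv := ?_
      right_inv := ?_
      map_toFun _ _ := rfl
      val_toFun _ := rfl }
  · intro (j : Fin (2 * g))
    dsimp only
    split_ifs with h
    · convert (x ⟨j.val / 2, by omega⟩).2.1
      dsimp only
      omega
    · convert (x ⟨j.val / 2, by omega⟩).2.2
      dsimp only
      omega
  · intro H v
    apply Subtype.ext
    funext (j : Fin (2 * g))
    dsimp only
    split_ifs with h
    · exact congrArg v.1 (Fin.ext (by dsimp only; omega))
    · exact congrArg v.1 (Fin.ext (by dsimp only; omega))
  · intro H x
    funext i
    apply Subtype.ext
    have h₀ : ∀ h, (⟨2 * i.val / 2, h⟩ : Fin g) = i := fun _ => Fin.ext (by dsimp only; omega)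
    have h₁ : ∀ h, (⟨(2 * i.val + 1) / 2, h⟩ : Fin g) = i :=
      fun _ => Fin.ext (by dsimp only; omega)
    refine Prod.ext ?_ ?_
    · change (if 2 * i.val % 2 = 0 then (x ⟨2 * i.val / 2, _⟩).1.1 else _) = _
      rw [if_pos (by omega), h₀]
    · change (if (2 * i.val + 1) % 2 = 0 then _ else (x ⟨(2 * i.val + 1) / 2, _⟩).1.2) = _
      rw [if_neg (by omega), h₁]

theorem cls_surface_o2 (g : ℕ) (τ : Fin (2 * g) → ElementType) :
    (surface .o2 g τ).cls =
      (List.ofFn fun i : Fin g =>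
        (handle (τ ⟨2 * i.val, by omega⟩) (τ ⟨2 * i.val + 1, by omega⟩)).cls).prod :=
  cls_surface_o1 g τ

theorem cls_surface_n1 (g : ℕ) (τ : Fin g → ElementType) :
    (surface .n1 g τ).cls = (List.ofFn fun i => (crosscap (τ i)).cls).prod := by
  rw [← cls_pi fun i => crosscap (τ i)]
  exact Iso.cls_eq
    { toFun := fun v i => ⟨v.1 i, v.2 i⟩
      invFun := fun x => ⟨fun i => (x i).1, fun i => (x i).2⟩
      left_inv _ := rfl
      right_inv _ := rfl
      map_toFun _ _ := rfl
      val_toFun _ := rfl }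

theorem cls_surface_n2 (g : ℕ) (τ : Fin g → ElementType) :
    (surface .n2 g τ).cls = (List.ofFn fun i => (crosscap (τ i)).cls).prod :=
  cls_surface_n1 g τ

theorem cls_surface_n3 (g : ℕ) (τ : Fin g → ElementType) :
    (surface .n3 g τ).cls = (List.ofFn fun i => (crosscap (τ i)).cls).prod :=
  cls_surface_n1 g τ

theorem cls_surface_n4 (g : ℕ) (τ : Fin g → ElementType) :
    (surface .n4 g τ).cls = (List.ofFn fun i => (crosscap (τ i)).cls).prod :=
  cls_surface_n1 g τ

end Block

namespace SeifertData

open Block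

/-- The block whose presented group is the fundamental group of `S`, with prescribed degrees of
the generators. -/
def block (S : SeifertData) (d : Fin S.n → Multiplicative (ZMod 2))
    (d' : Fin S.g' → Multiplicative (ZMod 2)) : Block :=
  (euler (-S.e)).tensor ((pi fun k => coneBlock (d k) (S.a k) (S.b k)).tensor
    (surface S.type S.g fun j => (d' j, S.type.signUnit j)))

/-- The fundamental group as a fibred group. -/
def fibredPi1 (S : SeifertData) (φ : S.Pi1 →* Multiplicative (ZMod 2)) (hφ : φ S.h = 1) :
    FibredGroup where
  carrier := S.Pi1
  fibre := S.h
  deg := φ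
  deg_fibre := hφ

theorem Relator.mk_eq_one {S : SeifertData} {r : S.Free} (hr : S.Relator r) :
    PresentedGroup.mk {r : S.Free | S.Relator r} r = 1 :=
  PresentedGroup.one_of_mem hr

theorem presents_block (S : SeifertData) (φ : S.Pi1 →* Multiplicative (ZMod 2))
    (hφ : φ S.h = 1) :
    ∃ x, (S.block (fun k => φ (S.s k)) (fun j => φ (S.v j))).Presents (S.fibredPi1 φ hφ) x := by
  have hs : ∀ k, HasType (H := S.fibredPi1 φ hφ) (S.s k) (φ (S.s k), 1) := by
    refine fun k => ⟨rfl, ?_⟩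
    have := (Relator.comm k).mk_eq_one
    simp only [SeifertType.commutator, map_mul, map_inv] at this
    rw [mul_inv_eq_one] at this
    rw [Units.val_one, zpow_one]
    exact this
  have hs' : ∀ k, S.s k ^ S.a k * S.h ^ S.b k = 1 := by
    intro k
    have := (Relator.fibre k).mk_eq_one
    simp only [map_mul, map_zpow] at this
    exact this
  have hv : ∀ j, HasType (H := S.fibredPi1 φ hφ) (S.v j) (φ (S.v j), S.type.signUnit j) := by
    refine fun j => ⟨rfl, ?_⟩
    have := (Relator.conj j).mk_eq_one
    simp only [map_mul, map_zpow, map_inv, zpow_neg] at this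
    rw [mul_inv_eq_one] at this
    rw [SeifertType.coe_signUnit]
    exact this
  refine ⟨((), (fun k => ⟨S.s k, hs k, hs' k⟩), ⟨S.v, hv⟩), ?_, ?_, ?_⟩
  · have := Relator.mk_eq_one (S := S) Relator.long
    simp only [map_mul, map_zpow, map_list_prod, List.map_ofFn, SeifertType.map_surfaceWord] at this
    rw [mul_assoc] at this
    exact this
  · rintro H ⟨_, y, ⟨v, hv⟩⟩ hy
    let F : SeifertGen S.n S.g' → H := fun
      | .s k => (y k).1
      | .v j => v j
      | .h => H.fibre
    have hF : ∀ r ∈ {r : S.Free | S.Relator r}, FreeGroup.lift F r = 1 := by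
      rintro r (k | k | j | _)
      · have := ((y k).2.1.commute rfl).eq
        simp only [SeifertType.commutator, map_mul, map_inv, fs, fh, FreeGroup.lift_apply_of]
        rw [mul_inv_eq_one, mul_inv_eq_iff_eq_mul]
        exact this
      · simp only [map_mul, map_zpow, fs, fh, FreeGroup.lift_apply_of]
        exact (y k).2.2
      · have := (hv j).2
        simp only [map_mul, map_zpow, map_inv, fv, fh, FreeGroup.lift_apply_of, zpow_neg]
        rw [mul_inv_eq_one, ← SeifertType.coe_signUnit]
        exact this
      · simp only [map_mul, map_zpow, map_list_prod, List.map_ofFn, SeifertType.map_surfaceWord,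
          fs, fv, fh, FreeGroup.lift_apply_of, Function.comp_def]
        rw [mul_assoc]
        exact hy
    have hd : H.deg.comp (PresentedGroup.toGroup hF) = φ := by
      apply PresentedGroup.ext
      rintro (k | j | _) <;> rw [MonoidHom.comp_apply, PresentedGroup.toGroup.of]
      · exact (y k).2.1.1
      · exact (hv j).1
      · exact H.deg_fibre.trans hφ.symm
    refine ⟨⟨PresentedGroup.toGroup hF, PresentedGroup.toGroup.of hF, DFunLike.congr_fun hd⟩, ?_⟩
    refine Prod.ext rfl (Prod.ext ?_ ?_)
    · funext k
      exact Subtype.ext (PresentedGroup.toGroup.of hF)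
    · apply Subtype.ext
      funext j
      exact PresentedGroup.toGroup.of hF
  · intro H f f' hf
    have : f.toMonoidHom = f'.toMonoidHom := by
      apply PresentedGroup.ext
      rintro (k | j | _)
      · exact congrArg Subtype.val (congrFun (congrArg (fun z => z.2.1) hf) k)
      · exact congrFun (congrArg (fun z => z.2.2.1) hf) j
      · exact f.map_fibre.trans f'.map_fibre.symm
    ext x
    exact DFunLike.congr_fun this x

end SeifertData

/-! ### Wreath products with `ℤ/2` -/

/-- The wreath product of `H` with `ℤ/2`: monomial `2 × 2` matrices with entries in `H`, where
`entry i` is the entry in row `i` and `shift` is the underlying permutation. -/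
@[ext] structure Wreath (H : Type) where
  entry : ZMod 2 → H
  shift : ZMod 2

namespace Wreath

variable {H : Type}

theorem forall_zmod_two {p : ZMod 2 → Prop} : (∀ i, p i) ↔ p 0 ∧ p 1 := Fin.forall_fin_two

theorem ext_iff_two {x y : Wreath H} :
    x = y ↔ x.entry 0 = y.entry 0 ∧ x.entry 1 = y.entry 1 ∧ x.shift = y.shift := by
  rw [Wreath.ext_iff, funext_iff, forall_zmod_two, and_assoc]

/-- The antidiagonal matrix with entries `p` and `q`. -/
def anti (p q : H) : Wreath H := ⟨fun i => if i = 0 then p else q, 1⟩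

theorem anti_eq {x : Wreath H} (hx : x.shift = 1) : anti (x.entry 0) (x.entry 1) = x :=
  ext_iff_two.2 ⟨rfl, rfl, hx.symm⟩

variable [Group H]

instance : Mul (Wreath H) := 
  ⟨fun x y => ⟨fun i => x.entry i * y.entry (i + x.shift), x.shift + y.shift⟩⟩

instance : One (Wreath H) := ⟨⟨fun _ => 1, 0⟩⟩

instance : Inv (Wreath H) := ⟨fun x => ⟨fun i => (x.entry (i - x.shift))⁻¹, -x.shift⟩⟩

@[simp] theorem mul_entry (x y : Wreath H) (i : ZMod 2) :
    (x * y).entry i = x.entry i * y.entry (i + x.shift) := rfl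

@[simp] theorem mul_shift (x y : Wreath H) : (x * y).shift = x.shift + y.shift := rfl

@[simp] theorem one_entry (i : ZMod 2) : (1 : Wreath H).entry i = 1 := rfl

@[simp] theorem one_shift : (1 : Wreath H).shift = 0 := rfl

@[simp] theorem inv_entry (x : Wreath H) (i : ZMod 2) :
    x⁻¹.entry i = (x.entry (i - x.shift))⁻¹ := rfl

@[simp] theorem inv_shift (x : Wreath H) : x⁻¹.shift = -x.shift := rfl

instance : Group (Wreath H) :=
  Group.ofLeftAxioms
    (fun x y z => Wreath.ext (funext fun i => by simp [mul_assoc, add_assoc]) (by simp [add_assoc]))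
    (fun x => Wreath.ext (funext fun i => by simp) (by simp))
    (fun x => Wreath.ext (funext fun i => by
      simp only [mul_entry, inv_entry, inv_shift, ← sub_eq_add_neg, inv_mul_cancel, one_entry])
      (neg_add_cancel x.shift))

/-- The diagonal matrices. -/
def diag : H × H →* Wreath H where
  toFun x := ⟨fun i => if i = 0 then x.1 else x.2, 0⟩
  map_one' := Wreath.ext (funext fun i => by simp) rfl
  map_mul' x y := Wreath.ext (funext fun i => by
    by_cases h : i = 0 <;> simp [h]) (by simp)

@[simp] theorem diag_entry_zero (x : H × H) : (diag x).entry 0 = x.1 := rfl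

@[simp] theorem diag_entry_one (x : H × H) : (diag x).entry 1 = x.2 := rfl

@[simp] theorem diag_shift (x : H × H) : (diag x).shift = 0 := rfl

theorem diag_eq {x : Wreath H} (hx : x.shift = 0) : diag (x.entry 0, x.entry 1) = x :=
  ext_iff_two.2 ⟨rfl, rfl, hx.symm⟩

theorem diag_const_zpow (h : H) (n : ℤ) : diag (h, h) ^ n = diag (h ^ n, h ^ n) := by
  rw [← map_zpow]; rfl

theorem diag_const_entry (h : H) (i : ZMod 2) : (diag (h, h)).entry i = h := by
  simp [diag]

theorem anti_mul_anti (p q p' q' : H) : anti p q * anti p' q' = diag (p * q', q * p') :=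
  ext_iff_two.2 ⟨rfl, rfl, (by decide : (1 + 1 : ZMod 2) = 0)⟩

end Wreath

namespace FibredGroup

/-- The wreath product with `ℤ/2` as a fibred group. The degrees in `H` play no role. -/
def wreath (H : FibredGroup) : FibredGroup where
  carrier := Wreath H
  fibre := Wreath.diag (H.fibre, H.fibre)
  deg :=
    { toFun x := Multiplicative.ofAdd x.shift
      map_one' := rfl
      map_mul' _ _ := rfl }
  deg_fibre := rfl

/-- The functoriality of the wreath product. -/
def Hom.wreath {H K : FibredGroup} (f : Hom H K) : Hom H.wreath K.wreath where
  toFun x := ⟨fun i => f (x.entry i), x.shift⟩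
  map_one' := Wreath.ext (funext fun _ => map_one f) rfl
  map_mul' x y := Wreath.ext (funext fun i => map_mul f (Wreath.entry (H := H) x i) _) rfl
  map_fibre' := Wreath.ext (funext fun i => by
    change f ((Wreath.diag _).entry i) = (Wreath.diag _).entry i
    rw [Wreath.diag_const_entry, Wreath.diag_const_entry, map_fibre]) rfl
  deg_map' _ := rfl

theorem hasType_wreath {H : FibredGroup} {x : Wreath H} {τ : ElementType} :
    HasType (H := H.wreath) x τ ↔ Multiplicative.ofAdd x.shift = τ.1 ∧
      ∀ i, x.entry i * H.fibre * (x.entry i)⁻¹ = H.fibre ^ (τ.2 : ℤ) := by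
  refine and_congr Iff.rfl ?_
  change x * Wreath.diag (H.fibre, H.fibre) * x⁻¹ = Wreath.diag (H.fibre, H.fibre) ^ (τ.2 : ℤ) ↔ _
  rw [Wreath.diag_const_zpow, Wreath.ext_iff, funext_iff]
  simp only [Wreath.mul_entry, Wreath.inv_entry, Wreath.diag_const_entry, Wreath.mul_shift,
    Wreath.diag_shift, Wreath.inv_shift, add_zero, add_sub_cancel_right, add_neg_cancel, and_true]

/-- All elements have trivial degree. -/
def TrivialDeg (H : FibredGroup) : Prop := ∀ x, H.deg x = 1

theorem TrivialDeg.hasType {H : FibredGroup} (hH : H.TrivialDeg) {x : H} {τ : ElementType}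
    (hτ : τ.1 = 1) (h : x * H.fibre * x⁻¹ = H.fibre ^ (τ.2 : ℤ)) : HasType x τ :=
  ⟨by rw [hτ, hH], h⟩

theorem HasType.entry {H : FibredGroup} (hH : H.TrivialDeg) {x : Wreath H} {τ : ElementType}
    (hτ : τ.1 = 1) (hx : HasType (H := H.wreath) x τ) (i : ZMod 2) : HasType (x.entry i) τ :=
  hH.hasType hτ ((hasType_wreath.1 hx).2 i)

theorem HasType.shift_eq_zero {H : FibredGroup} {x : Wreath H} {τ : ElementType}
    (hτ : τ.1 = 1) (hx : HasType (H := H.wreath) x τ) : x.shift = 0 :=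
  (hasType_wreath.1 hx).1.trans hτ

theorem HasType.diag {H : FibredGroup} {x y : H} {τ : ElementType}
    (hτ : τ.1 = 1) (hx : HasType x τ) (hy : HasType y τ) :
    HasType (H := H.wreath) (Wreath.diag (x, y)) τ := by
  refine hasType_wreath.2 ⟨hτ.symm, Wreath.forall_zmod_two.2 ⟨hx.2, hy.2⟩⟩

theorem TrivialDeg.hasType_of_commute {H : FibredGroup} (hH : H.TrivialDeg) {x : H}
    (h : Commute x H.fibre) : HasType x 1 :=
  (HasType.of_commute h).congr (Prod.ext (hH x) rfl)

end FibredGroup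

/-! ### Pair blocks -/

/-- A functor from fibred groups to types with two natural maps to the underlying group. -/
structure PairBlock where
  Sol : FibredGroup → Type
  map : ∀ {H K : FibredGroup}, Hom H K → Sol H → Sol K
  val : ∀ {H : FibredGroup}, Sol H → H × H

namespace PairBlock

/-- Bijections, natural among the fibred groups of trivial degree, that preserve the values. -/
structure Iso (A B : PairBlock) where
  toFun : ∀ {H : FibredGroup}, H.TrivialDeg → A.Sol H → B.Sol H
  invFun : ∀ {H : FibredGroup}, H.TrivialDeg → B.Sol H → A.Sol H
  left_inv : ∀ {H : FibredGroup} (hH : H.TrivialDeg) (x : A.Sol H), invFun hH (toFun hH x) = x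
  right_inv : ∀ {H : FibredGroup} (hH : H.TrivialDeg) (y : B.Sol H), toFun hH (invFun hH y) = y
  map_toFun : ∀ {H K : FibredGroup} (hH : H.TrivialDeg) (hK : K.TrivialDeg) (f : Hom H K)
    (x : A.Sol H), toFun hK (A.map f x) = B.map f (toFun hH x)
  val_toFun : ∀ {H : FibredGroup} (hH : H.TrivialDeg) (x : A.Sol H),
    B.val (toFun hH x) = A.val x

namespace Iso

variable {A B C : PairBlock}

theorem map_invFun (e : Iso A B) {H K : FibredGroup} (hH : H.TrivialDeg) (hK : K.TrivialDeg)
    (f : Hom H K) (y : B.Sol H) : e.invFun hK (B.map f y) = A.map f (e.invFun hH y) := by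
  rw [← e.left_inv hK (A.map f _), e.map_toFun hH hK, e.right_inv]

theorem val_invFun (e : Iso A B) {H : FibredGroup} (hH : H.TrivialDeg) (y : B.Sol H) :
    A.val (e.invFun hH y) = B.val y := by
  rw [← e.val_toFun hH, e.right_inv]

/-- The identity. -/
def refl (A : PairBlock) : Iso A A where
  toFun _ x := x
  invFun _ x := x
  left_inv _ _ := rfl
  right_inv _ _ := rfl
  map_toFun _ _ _ _ := rfl
  val_toFun _ _ := rfl

/-- Composition. -/
def trans (e : Iso A B) (e' : Iso B C) : Iso A C where
  toFun hH x := e'.toFun hH (e.toFun hH x)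
  invFun hH x := e.invFun hH (e'.invFun hH x)
  left_inv hH x := by rw [e'.left_inv, e.left_inv]
  right_inv hH x := by rw [e.right_inv, e'.right_inv]
  map_toFun hH hK f x := by rw [e.map_toFun hH hK, e'.map_toFun hH hK]
  val_toFun hH x := by rw [e'.val_toFun, e.val_toFun]

end Iso

/-- Juxtaposition of two pair blocks. -/
def tensor (A B : PairBlock) : PairBlock where
  Sol H := A.Sol H × B.Sol H
  map f x := (A.map f x.1, B.map f x.2)
  val x := A.val x.1 * B.val x.2

namespace Iso

/-- Juxtaposition of isomorphisms. -/
def tensor {A A' B B' : PairBlock} (e : Iso A A') (e' : Iso B B') :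
    Iso (A.tensor B) (A'.tensor B') where
  toFun hH x := (e.toFun hH x.1, e'.toFun hH x.2)
  invFun hH x := (e.invFun hH x.1, e'.invFun hH x.2)
  left_inv hH x := Prod.ext (e.left_inv hH x.1) (e'.left_inv hH x.2)
  right_inv hH x := Prod.ext (e.right_inv hH x.1) (e'.right_inv hH x.2)
  map_toFun hH hK f x := Prod.ext (e.map_toFun hH hK f x.1) (e'.map_toFun hH hK f x.2)
  val_toFun hH x := congrArg₂ (· * ·) (e.val_toFun hH x.1) (e'.val_toFun hH x.2)

/-- Juxtaposition is associative. -/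
def assocInv (A B C : PairBlock) : Iso (A.tensor (B.tensor C)) ((A.tensor B).tensor C) where
  toFun _ x := ((x.1, x.2.1), x.2.2)
  invFun _ x := (x.1.1, x.1.2, x.2)
  left_inv _ _ := rfl
  right_inv _ _ := rfl
  map_toFun _ _ _ _ := rfl
  val_toFun _ x := mul_assoc (A.val x.1) (B.val x.2.1) (C.val x.2.2)

end Iso

/-- The solutions of a block in the wreath product. If the values of the block have trivial
degree, they are pairs. -/
def ofWreath (A : Block) : PairBlock where
  Sol H := A.Sol H.wreath
  map f x := A.map f.wreath x
  val x := ((A.val x).entry 0, (A.val x).entry 1)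

/-- Two independent solutions of a block. -/
def double (A : Block) : PairBlock where
  Sol H := A.Sol H × A.Sol H
  map f x := (A.map f x.1, A.map f x.2)
  val x := (A.val x.1, A.val x.2)

/-- A solution of a block, with its value written as a product `Y X` in all ways such that `X`
commutes with the fibre; the values are `X` and `Y`. -/
def factored (A : Block) : PairBlock where
  Sol H := A.Sol H × {X : H // Commute X H.fibre}
  map f x := (A.map f x.1, ⟨f x.2.1, by simpa using x.2.2.map f⟩)
  val x := (x.2.1, A.val x.1 * x.2.1⁻¹)

end PairBlock

namespace Block

/-- The values of the block have trivial degree. -/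
def DegZero (A : Block) : Prop := ∀ {H : FibredGroup} (x : A.Sol H), H.deg (A.val x) = 1

theorem DegZero.shift {A : Block} (hA : A.DegZero) {H : FibredGroup} (x : A.Sol H.wreath) :
    Wreath.shift (H := H) (A.val x) = 0 := hA x

theorem degZero_one : one.DegZero := fun {H} _ => map_one H.deg

theorem DegZero.tensor {A B : Block} (hA : A.DegZero) (hB : B.DegZero) : (A.tensor B).DegZero :=
  fun {H} x => (map_mul H.deg _ _).trans (by rw [hA, hB, one_mul])

end Block

open Block

namespace PairBlock

/-- Solutions in the wreath product of a juxtaposition. -/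
def tensorOfWreath {A : Block} (hA : A.DegZero) (B : Block) :
    Iso (ofWreath (A.tensor B)) ((ofWreath A).tensor (ofWreath B)) where
  toFun _ x := x
  invFun _ x := x
  left_inv _ _ := rfl
  right_inv _ _ := rfl
  map_toFun _ _ _ _ := rfl
  val_toFun {H} _ x := by
    have h := hA.shift (H := H) x.1
    have h' : ∀ i, Wreath.entry (H := H) ((A.tensor B).val x) i =
        Wreath.entry (H := H) (A.val x.1) i * Wreath.entry (H := H) (B.val x.2) i := by
      intro i
      change _ * Wreath.entry (H := H) (B.val x.2) (i + Wreath.shift (H := H) (A.val x.1)) = _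
      rw [h, add_zero]
    exact Prod.ext (h' 0).symm (h' 1).symm

/-- A juxtaposition of doubles. -/
def tensorDouble (A B : Block) : Iso ((double A).tensor (double B)) (double (A.tensor B)) where
  toFun _ x := ((x.1.1, x.2.1), (x.1.2, x.2.2))
  invFun _ x := ((x.1.1, x.2.1), (x.1.2, x.2.2))
  left_inv _ _ := rfl
  right_inv _ _ := rfl
  map_toFun _ _ _ _ := rfl
  val_toFun _ _ := rfl

/-- The empty block can be dropped. -/
def tensorOfWreathOne (A : PairBlock) : Iso (A.tensor (ofWreath one)) A where
  toFun _ x := x.1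
  invFun _ x := (x, ())
  left_inv _ _ := rfl
  right_inv _ _ := rfl
  map_toFun _ _ _ _ := rfl
  val_toFun _ x := (mul_one (A.val x.1)).symm

end PairBlock

namespace Block

/-- The block lifts to two copies of itself in the double cover: its values have trivial degree,
and its solutions in the wreath product are pairs of solutions. -/
def Splits (A : Block) : Prop :=
  A.DegZero ∧ Nonempty (PairBlock.Iso (PairBlock.ofWreath A) (PairBlock.double A))

theorem splits_one : one.Splits :=
  ⟨degZero_one, ⟨{
    toFun _ _ := ((), ())
    invFun _ _ := ()
    left_inv _ _ := rfl
    right_inv _ _ := rfl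
    map_toFun _ _ _ _ := rfl
    val_toFun _ _ := rfl }⟩⟩

theorem Splits.tensor {A B : Block} (hA : A.Splits) (hB : B.Splits) : (A.tensor B).Splits := by
  obtain ⟨hA, ⟨e⟩⟩ := hA
  obtain ⟨hB, ⟨e'⟩⟩ := hB
  exact ⟨hA.tensor hB, ⟨(PairBlock.tensorOfWreath hA B).trans
    ((e.tensor e').trans (PairBlock.tensorDouble A B))⟩⟩

theorem Splits.list {l : List Block} (hl : ∀ A ∈ l, A.Splits) : (Block.list l).Splits := by
  induction l with
  | nil => exact splits_one
  | cons A l ih =>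
    exact (hl A (by simp)).tensor (ih fun B hB => hl B (by simp [hB]))

theorem splits_euler (e : ℤ) : (euler e).Splits := by
  refine ⟨fun {H} _ => by
    change H.deg (H.fibre ^ e) = 1
    rw [map_zpow, H.deg_fibre, one_zpow], ⟨{
      toFun _ _ := ((), ())
      invFun _ _ := ()
      left_inv _ _ := rfl
      right_inv _ _ := rfl
      map_toFun _ _ _ _ := rfl
      val_toFun {H} _ _ := ?_ }⟩⟩
  have h := Wreath.diag_const_zpow H.fibre e
  exact Prod.ext (congrArg (fun z => z.entry 0) h).symm (congrArg (fun z => z.entry 1) h).symm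

theorem splits_coneBlock (a b : ℤ) : (coneBlock 1 a b).Splits := by
  have key : ∀ {H : FibredGroup} (x y : H),
      (Wreath.diag (x, y) ^ a * Wreath.diag (H.fibre, H.fibre) ^ b = 1) ↔
        x ^ a * H.fibre ^ b = 1 ∧ y ^ a * H.fibre ^ b = 1 := by
    intro H x y
    rw [← map_zpow, ← map_zpow, ← map_mul, ← map_one Wreath.diag, Wreath.ext_iff_two]
    simp
  refine ⟨fun x => x.2.1.1, ⟨{
    toFun := fun {H} hH x => (⟨x.1.entry 0, x.2.1.entry hH rfl 0,
        ((key (H := H) (x.1.entry 0) (x.1.entry 1)).1 (by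
          rw [Wreath.diag_eq (x.2.1.shift_eq_zero rfl)]; exact x.2.2)).1⟩,
      ⟨x.1.entry 1, x.2.1.entry hH rfl 1,
        ((key (H := H) (x.1.entry 0) (x.1.entry 1)).1 (by
          rw [Wreath.diag_eq (x.2.1.shift_eq_zero rfl)]; exact x.2.2)).2⟩)
    invFun := fun {H} hH x => ⟨Wreath.diag (x.1.1, x.2.1), x.1.2.1.diag rfl x.2.2.1,
      (key x.1.1 x.2.1).2 ⟨x.1.2.2, x.2.2.2⟩⟩
    left_inv := fun {H} hH x => Subtype.ext (Wreath.diag_eq (x.2.1.shift_eq_zero rfl))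
    right_inv := fun {H} hH x => rfl
    map_toFun := fun _ _ _ _ => rfl
    val_toFun := fun _ _ => rfl }⟩⟩

theorem commutatorProd_eq_one {A : Type*} [CommGroup A] (g : ℕ) (v : Fin (2 * g) → A) :
    SeifertType.commutatorProd g v = 1 := by
  apply List.prod_eq_one
  intro x hx
  obtain ⟨i, rfl⟩ := List.mem_ofFn.1 hx
  simp [SeifertType.commutator]

theorem squareProd_eq_one {A : Type*} [Group A] (hA : ∀ x : A, x ^ 2 = 1) (g : ℕ)
    (v : Fin g → A) : SeifertType.squareProd g v = 1 := by
  apply List.prod_eq_one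
  intro x hx
  obtain ⟨i, rfl⟩ := List.mem_ofFn.1 hx
  exact hA _

theorem surfaceWord_eq_one {A : Type*} [CommGroup A] (hA : ∀ x : A, x ^ 2 = 1) (t : SeifertType)
    (g : ℕ) (v : Fin (t.numV g) → A) : t.surfaceWord g v = 1 := by
  cases t
  exacts [commutatorProd_eq_one g v, commutatorProd_eq_one g v, squareProd_eq_one hA g v,
    squareProd_eq_one hA g v, squareProd_eq_one hA g v, squareProd_eq_one hA g v]

theorem degZero_surface (t : SeifertType) (g : ℕ) (τ : Fin (t.numV g) → ElementType) :
    (surface t g τ).DegZero := fun {H} v =>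
  (SeifertType.map_surfaceWord H.deg t g v.1).trans (surfaceWord_eq_one (by decide) t g _)

theorem splits_surface (t : SeifertType) (g : ℕ) (τ : Fin (t.numV g) → ElementType)
    (hτ : ∀ j, (τ j).1 = 1) : (surface t g τ).Splits := by
  have left : ∀ {H : FibredGroup} (v : (surface t g τ).Sol H.wreath),
      (fun j => Wreath.diag (H := H) ((v.1 j).entry 0, (v.1 j).entry 1)) = v.1 :=
    fun v => funext fun j => Wreath.diag_eq ((v.2 j).shift_eq_zero (hτ j))
  refine ⟨degZero_surface t g τ, ⟨{
    toFun := fun hH v => (⟨fun j => (v.1 j).entry 0, fun j => (v.2 j).entry hH (hτ j) 0⟩,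
      ⟨fun j => (v.1 j).entry 1, fun j => (v.2 j).entry hH (hτ j) 1⟩)
    invFun := fun hH v => ⟨fun j => Wreath.diag (v.1.1 j, v.2.1 j),
      fun j => (v.1.2 j).diag (hτ j) (v.2.2 j)⟩
    left_inv := fun _ v => Subtype.ext (left v)
    right_inv := fun _ _ => rfl
    map_toFun := fun _ _ _ _ => rfl
    val_toFun := fun {H} hH v => ?_ }⟩⟩
  let w : Fin (t.numV g) → H × H := fun j => ((v.1 j).entry 0, (v.1 j).entry 1)
  have h : Wreath.diag (t.surfaceWord g w) = (surface t g τ).val v :=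
    (SeifertType.map_surfaceWord Wreath.diag t g w).trans (congrArg (t.surfaceWord g) (left v))
  refine Prod.ext ?_ ?_
  · refine Eq.trans ?_ (congrArg (fun z => Wreath.entry (H := H) z 0) h)
    exact (SeifertType.map_surfaceWord (MonoidHom.fst H H) t g w).symm
  · refine Eq.trans ?_ (congrArg (fun z => Wreath.entry (H := H) z 1) h)
    exact (SeifertType.map_surfaceWord (MonoidHom.snd H H) t g w).symm

end Block

/-! ### Branched fibres in the double cover -/

namespace PairBlock

/-- The generator of `ℤ/2`, written multiplicatively. -/
abbrev odd : Multiplicative (ZMod 2) := Multiplicative.ofAdd 1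

/-- Antidiagonal matrices that commute with the fibre and whose square satisfies the relation of a
cone block. -/
def ConeCover (H : FibredGroup) (a b : ℤ) : Type :=
  {x : H × H // Commute x.1 H.fibre ∧ Commute x.2 H.fibre ∧ (x.1 * x.2) ^ a * H.fibre ^ b = 1}

/-- A relation that involves an even power of an antidiagonal matrix holds if it does in the first
row, since the second row is conjugate to the first. -/
theorem anti_rel_iff {H : FibredGroup} {p q : H} (hp : Commute p H.fibre) {a b : ℤ} :
    Wreath.anti p q ^ (2 * a) * Wreath.diag (H.fibre, H.fibre) ^ b = 1 ↔
      (p * q) ^ a * H.fibre ^ b = 1 := by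
  rw [zpow_mul, zpow_two, Wreath.anti_mul_anti, ← map_zpow, ← map_zpow, ← map_mul,
    ← map_one Wreath.diag, Wreath.ext_iff_two]
  refine ⟨fun h => h.1, fun h => ⟨h, ?_, rfl⟩⟩
  change (q * p) ^ a * H.fibre ^ b = 1
  have h₁ : q * p = p⁻¹ * (p * q) * p⁻¹⁻¹ := by group
  have h₂ : H.fibre ^ b = p⁻¹ * H.fibre ^ b * p⁻¹⁻¹ := by
    rw [((hp.zpow_right b).inv_left).eq]; group
  rw [h₁, conj_zpow, h₂]
  calc p⁻¹ * (p * q) ^ a * p⁻¹⁻¹ * (p⁻¹ * H.fibre ^ b * p⁻¹⁻¹)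
      = p⁻¹ * ((p * q) ^ a * H.fibre ^ b) * p := by group
    _ = 1 := by rw [h]; group

/-- The solutions in the wreath product of a cone block of odd degree. -/
def coneEquiv (H : FibredGroup) (a b : ℤ) :
    (coneBlock odd (2 * a) b).Sol H.wreath ≃ ConeCover H a b where
  toFun x := ⟨(x.1.entry 0, x.1.entry 1), by
    have hc : ∀ i, Commute (x.1.entry i) H.fibre := fun i => by
      have := (hasType_wreath.1 x.2.1).2 i
      rw [Units.val_one, zpow_one, mul_inv_eq_iff_eq_mul] at this
      exact this
    refine ⟨hc 0, hc 1, (anti_rel_iff (hc 0)).1 ?_⟩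
    rw [Wreath.anti_eq (hasType_wreath.1 x.2.1).1]
    exact x.2.2⟩
  invFun y := ⟨Wreath.anti y.1.1 y.1.2, hasType_wreath.2 ⟨rfl, Wreath.forall_zmod_two.2
    ⟨(HasType.of_commute y.2.1).2, (HasType.of_commute y.2.2.1).2⟩⟩,
      (anti_rel_iff y.2.1).2 y.2.2.2⟩
  left_inv x := Subtype.ext (Wreath.anti_eq (hasType_wreath.1 x.2.1).1)
  right_inv _ := rfl

/-- The preimage of two cone blocks of odd degree. -/
def conePair (a b c d : ℤ) : PairBlock where
  Sol H := ConeCover H a b × ConeCover H c d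
  map f x := (⟨(f x.1.1.1, f x.1.1.2), by simpa using x.1.2.1.map f,
      by simpa using x.1.2.2.1.map f, by simpa using congrArg f x.1.2.2.2⟩,
    ⟨(f x.2.1.1, f x.2.1.2), by simpa using x.2.2.1.map f,
      by simpa using x.2.2.2.1.map f, by simpa using congrArg f x.2.2.2.2⟩)
  val x := (x.1.1.1 * x.2.1.2, x.1.1.2 * x.2.1.1)

/-- Two cone blocks of odd degree. -/
abbrev oddPair (a b c d : ℤ) : Block :=
  (coneBlock odd (2 * a) b).tensor (coneBlock odd (2 * c) d)

theorem degZero_oddPair (a b c d : ℤ) : (oddPair a b c d).DegZero := fun {H} x => by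
  change H.deg (x.1.1 * x.2.1) = 1
  rw [map_mul, x.1.2.1.1, x.2.2.1.1]
  rfl

/-- The solutions in the wreath product of two cone blocks of odd degree. -/
def ofWreathOddPair (a b c d : ℤ) : Iso (ofWreath (oddPair a b c d)) (conePair a b c d) where
  toFun {H} _ x := (coneEquiv H a b x.1, coneEquiv H c d x.2)
  invFun {H} _ x := ((coneEquiv H a b).symm x.1, (coneEquiv H c d).symm x.2)
  left_inv _ x := Prod.ext (Equiv.symm_apply_apply _ _) (Equiv.symm_apply_apply _ _)
  right_inv _ x := Prod.ext (Equiv.apply_symm_apply _ _) (Equiv.apply_symm_apply _ _)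
  map_toFun _ _ _ _ := rfl
  val_toFun {H} _ x := by
    have h := (hasType_wreath.1 x.1.2.1).1
    have h₀ : ∀ i, Wreath.entry (H := H) ((oddPair a b c d).val x) i =
        x.1.1.entry i * x.2.1.entry (i + 1) := by
      intro i
      have h' : Wreath.shift (H := H) x.1.1 = 1 := h
      rw [← h']
      rfl
    exact Prod.ext (h₀ 0).symm (h₀ 1).symm

/-- The solutions in the wreath product of two cone blocks of odd degree, where the upper right
entry of the first matrix is `1`. -/
def normalizedOddPair (a b c d : ℤ) : PairBlock where
  Sol H := {x : (oddPair a b c d).Sol H.wreath // Wreath.entry (H := H) x.1.1 0 = 1}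
  map f x := ⟨(oddPair a b c d).map f.wreath x.1, (congrArg f x.2).trans (map_one f)⟩
  val x := (ofWreath (oddPair a b c d)).val x.1

/-- The preimage of two branched fibres consists of two fibres, the squares of the generators,
and is connected. -/
def normalizedOddPairIso (a b c d : ℤ) : Iso (normalizedOddPair a b c d)
    (factored ((coneBlock 1 a b).tensor (coneBlock 1 c d))) where
  toFun {H} hH x :=
    let y := coneEquiv H a b x.1.1
    let z := coneEquiv H c d x.1.2
    ((⟨y.1.2, hH.hasType_of_commute y.2.2.1, by
        have h₁ : y.1.1 = 1 := x.2
        have h₂ := y.2.2.2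
        rwa [h₁, one_mul] at h₂⟩,
      ⟨z.1.1 * z.1.2, hH.hasType_of_commute (z.2.1.mul_left z.2.2.1), z.2.2.2⟩),
      ⟨z.1.2, z.2.2.1⟩)
  invFun {H} hH x := ⟨((coneEquiv H a b).symm ⟨(1, x.1.1.1), Commute.one_left _,
      x.1.1.2.1.commute rfl, by simpa using x.1.1.2.2⟩,
    (coneEquiv H c d).symm ⟨(x.1.2.1 * x.2.1⁻¹, x.2.1),
      (x.1.2.2.1.commute rfl).mul_left x.2.2.inv_left, x.2.2, by
        simpa using x.1.2.2.2⟩), rfl⟩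
  left_inv {H} hH x := by
    apply Subtype.ext
    refine Prod.ext ?_ ?_
    · apply (coneEquiv H a b).injective
      exact (Equiv.apply_symm_apply _ _).trans (Subtype.ext (Prod.ext x.2.symm rfl))
    · apply (coneEquiv H c d).injective
      exact (Equiv.apply_symm_apply _ _).trans
        (Subtype.ext (Prod.ext (mul_inv_cancel_right _ _) rfl))
  right_inv {H} hH x :=
    Prod.ext (Prod.ext rfl (Subtype.ext (inv_mul_cancel_right _ _))) rfl
  map_toFun {H K} hH hK f x :=
    Prod.ext (Prod.ext rfl (Subtype.ext (map_mul f (Wreath.entry (H := H) x.1.2.1 0) _).symm)) rfl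
  val_toFun {H} hH x := by
    have h := (ofWreathOddPair a b c d).val_toFun hH x.1
    refine Eq.trans ?_ h
    have h₁ : Wreath.entry (H := H) x.1.1.1 0 = 1 := x.2
    refine Prod.ext ?_ ?_
    · change _ = Wreath.entry (H := H) x.1.1.1 0 * _
      rw [h₁, one_mul]
      rfl
    · change _ * (_ * _) * _ = _ * _
      rw [← mul_assoc, mul_inv_cancel_right]
      rfl

/-- Two further branched fibres contribute two fibres and a handle to the preimage. If the values
of the first part are `X` and `Y`, and the new generators are represented by antidiagonal matrices
with entries `p`, `q` and `p'`, `q'`, the handle is given by `n = X⁻¹ q` and `w = q'⁻¹ X`. -/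
def factoredConePair (A : Block) (a b c d : ℤ) : Iso ((factored A).tensor (conePair a b c d))
    (factored (A.tensor ((coneBlock 1 c d).tensor
      ((coneBlock 1 a b).tensor (handle 1 1))))) where
  toFun := fun {H} hH ⟨⟨ω, ⟨X, hX⟩⟩, ⟨⟨(p, q), h⟩, ⟨(p', q'), h'⟩⟩⟩ =>
    have hn : Commute (X⁻¹ * q) H.fibre := hX.inv_left.mul_left h.2.1
    have hw : Commute (q'⁻¹ * X) H.fibre := h'.2.1.inv_left.mul_left hX
    have hn' := hH.hasType_of_commute hn
    have hw' := hH.hasType_of_commute hw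
    have hnw := hH.hasType_of_commute (hn.mul_left hw)
    ((ω, ⟨(X⁻¹ * q) * (p' * q') * (X⁻¹ * q)⁻¹,
        hn'.conj (hH.hasType_of_commute (h'.1.mul_left h'.2.1)),
        hn'.conj_rel_of_eq_one rfl h'.2.2⟩,
      ⟨((X⁻¹ * q) * (q'⁻¹ * X)) * (p * q) * ((X⁻¹ * q) * (q'⁻¹ * X))⁻¹,
        hnw.conj (hH.hasType_of_commute (h.1.mul_left h.2.1)),
        hnw.conj_rel_of_eq_one rfl h.2.2⟩,
      ⟨(X⁻¹ * q, q'⁻¹ * X), hn', hw'⟩), ⟨X * p * q', (hX.mul_left h.1).mul_left h'.2.1⟩)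
  invFun := fun {H} hH ⟨⟨ω, ⟨s', hs'⟩, ⟨s, hs⟩, ⟨(n, w), hnw⟩⟩, ⟨X', hX'⟩⟩ =>
    have hn : Commute n H.fibre := hnw.1.commute rfl
    have hw : Commute w H.fibre := hnw.2.commute rfl
    have cs : Commute s H.fibre := hs.1.commute rfl
    have cs' : Commute s' H.fibre := hs'.1.commute rfl
    have hg := hn.mul_left hw
    have hX : Commute (X' * (w * n * w⁻¹ * n⁻¹) * s⁻¹ * (n * w)) H.fibre :=
      ((hX'.mul_left (((hw.mul_left hn).mul_left hw.inv_left).mul_left hn.inv_left)).mul_left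
        cs.inv_left).mul_left hg
    have hq := hX.mul_left hn
    have hq' := hX.mul_left hw.inv_left
    have ht := (hg.inv_left.mul_left cs).mul_left hg
    have ht' := (hn.inv_left.mul_left cs').mul_left hn
    ((ω, ⟨X' * (w * n * w⁻¹ * n⁻¹) * s⁻¹ * (n * w), hX⟩),
      (⟨((n * w)⁻¹ * s * (n * w) * (X' * (w * n * w⁻¹ * n⁻¹) * s⁻¹ * (n * w) * n)⁻¹,
          X' * (w * n * w⁻¹ * n⁻¹) * s⁻¹ * (n * w) * n),
        ht.mul_left hq.inv_left, hq, by
          have := (hH.hasType_of_commute hg.inv_left).conj_rel_of_eq_one rfl hs.2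
          rw [inv_inv] at this
          dsimp only
          rwa [inv_mul_cancel_right]⟩,
      ⟨(n⁻¹ * s' * n * (X' * (w * n * w⁻¹ * n⁻¹) * s⁻¹ * (n * w) * w⁻¹)⁻¹,
          X' * (w * n * w⁻¹ * n⁻¹) * s⁻¹ * (n * w) * w⁻¹),
        ht'.mul_left hq'.inv_left, hq', by
          have := (hH.hasType_of_commute hn.inv_left).conj_rel_of_eq_one rfl hs'.2
          rw [inv_inv] at this
          dsimp only
          rwa [inv_mul_cancel_right]⟩))
  left_inv := fun {H} hH ⟨⟨ω, ⟨X, hX⟩⟩, ⟨⟨(p, q), h⟩, ⟨(p', q'), h'⟩⟩⟩ => by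
    refine Prod.ext (Prod.ext rfl (Subtype.ext ?_))
      (Prod.ext (Subtype.ext (Prod.ext ?_ ?_)) (Subtype.ext (Prod.ext ?_ ?_))) <;>
      dsimp only <;> group
  right_inv := fun {H} hH ⟨⟨ω, ⟨s', hs'⟩, ⟨s, hs⟩, ⟨(n, w), hnw⟩⟩, ⟨X', hX'⟩⟩ => by
    refine Prod.ext (Prod.ext rfl (Prod.ext (Subtype.ext ?_) (Prod.ext (Subtype.ext ?_)
      (Subtype.ext (Prod.ext ?_ ?_))))) (Subtype.ext ?_) <;>
      dsimp only <;> group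
  map_toFun := fun {H K} hH hK f ⟨⟨ω, ⟨X, hX⟩⟩, ⟨⟨(p, q), h⟩, ⟨(p', q'), h'⟩⟩⟩ => by
    refine Prod.ext (Prod.ext rfl (Prod.ext (Subtype.ext ?_) (Prod.ext (Subtype.ext ?_)
      (Subtype.ext (Prod.ext ?_ ?_))))) (Subtype.ext ?_) <;>
      simp [PairBlock.tensor, factored, conePair, Block.tensor, coneBlock, handle]
  val_toFun := fun {H} hH ⟨⟨ω, ⟨X, hX⟩⟩, ⟨⟨(p, q), h⟩, ⟨(p', q'), h'⟩⟩⟩ => by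
    refine Prod.ext ?_ ?_ <;>
      simp only [PairBlock.tensor, factored, conePair, Block.tensor, coneBlock, handle,
        Prod.fst_mul, Prod.snd_mul] <;> group

/-- The preimage of a list of pairs of branched fibres. -/
theorem exists_iso_factored (l : List ((ℤ × ℤ) × (ℤ × ℤ))) (A : Block) :
    ∃ A' : Block, A'.cls = A.cls * ((l.map fun p => (coneBlock 1 p.1.1 p.1.2).cls *
        (coneBlock 1 p.2.1 p.2.2).cls).prod * (handle 1 1).cls ^ l.length) ∧
      Nonempty (Iso ((factored A).tensor (ofWreath (Block.list
        (l.map fun p => oddPair p.1.1 p.1.2 p.2.1 p.2.2)))) (factored A')) := by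
  induction l generalizing A with
  | nil => exact ⟨A, by simp, ⟨tensorOfWreathOne _⟩⟩
  | cons p l ih =>
    obtain ⟨A', hA', ⟨e⟩⟩ := ih (A.tensor ((coneBlock 1 p.2.1 p.2.2).tensor
      ((coneBlock 1 p.1.1 p.1.2).tensor (handle 1 1))))
    refine ⟨A', ?_, ⟨?_⟩⟩
    · rw [hA', cls_tensor, cls_tensor, cls_tensor, List.map_cons, List.prod_cons,
        List.length_cons, pow_succ]
      simp only [mul_comm, mul_left_comm, mul_assoc]
    · refine ((Iso.refl _).tensor (tensorOfWreath (degZero_oddPair _ _ _ _) _)).trans ?_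
      refine (Iso.assocInv _ _ _).trans ?_
      exact ((((Iso.refl _).tensor (ofWreathOddPair _ _ _ _)).trans
        (factoredConePair A _ _ _ _)).tensor (Iso.refl _)).trans e

end PairBlock

open PairBlock

/-! ### The kernel of the degree -/

namespace FibredGroup

/-- The kernel of the degree. -/
def ker (G : FibredGroup) : FibredGroup where
  carrier := G.deg.ker
  fibre := ⟨G.fibre, G.deg_fibre⟩
  deg := 1
  deg_fibre := rfl

theorem trivialDeg_ker (G : FibredGroup) : G.ker.TrivialDeg := fun _ => rfl

variable {G : FibredGroup} {t : G}

/-- The representatives `1`, `t` of the two cosets of the kernel. -/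
def transversal (t : G) (i : ZMod 2) : G := if i = 0 then 1 else t

theorem deg_transversal (ht : G.deg t = odd) (i : ZMod 2) :
    G.deg (transversal t i) = Multiplicative.ofAdd i := by
  revert i
  exact Wreath.forall_zmod_two.2 ⟨map_one G.deg, ht⟩

theorem commute_transversal (ht : Commute t G.fibre) (i : ZMod 2) :
    Commute (transversal t i) G.fibre := by
  unfold transversal
  split_ifs
  · exact Commute.one_left _
  · exact ht

/-- The homomorphism to the wreath product of the kernel that is induced from the identity of the
kernel; `t` is an element of degree `1`. -/
def toWreathKer (ht : G.deg t = odd) (ht' : Commute t G.fibre) : Hom G G.ker.wreath where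
  toFun g := ⟨fun i => ⟨transversal t i * g * (transversal t (i + (G.deg g).toAdd))⁻¹, by
    rw [MonoidHom.mem_ker, map_mul, map_mul, map_inv, deg_transversal ht, deg_transversal ht,
      ofAdd_add, ofAdd_toAdd, mul_inv_cancel]⟩, (G.deg g).toAdd⟩
  map_one' := Wreath.ext (funext fun i => Subtype.ext (by
    change transversal t i * 1 * (transversal t (i + (G.deg 1).toAdd))⁻¹ = 1
    simp)) (congrArg Multiplicative.toAdd (map_one G.deg))
  map_mul' x y := Wreath.ext (funext fun i => Subtype.ext (by
    change transversal t i * (x * y) * (transversal t (i + (G.deg (x * y)).toAdd))⁻¹ =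
      transversal t i * x * (transversal t (i + (G.deg x).toAdd))⁻¹ *
      (transversal t (i + (G.deg x).toAdd) * y *
        (transversal t (i + (G.deg x).toAdd + (G.deg y).toAdd))⁻¹)
    rw [map_mul, toAdd_mul, add_assoc]
    group)) (congrArg Multiplicative.toAdd (map_mul G.deg x y))
  map_fibre' := Wreath.ext (funext fun i => Subtype.ext (by
    change transversal t i * G.fibre * (transversal t (i + (G.deg G.fibre).toAdd))⁻¹ =
      ((Wreath.diag (G.ker.fibre, G.ker.fibre)).entry i).1
    rw [G.deg_fibre, toAdd_one, add_zero, (commute_transversal ht' i).eq, mul_inv_cancel_right,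
      Wreath.diag_const_entry]
    rfl)) (congrArg Multiplicative.toAdd G.deg_fibre)
  deg_map' _ := rfl

theorem toWreathKer_entry (ht : G.deg t = odd) (ht' : Commute t G.fibre) (g : G) (i : ZMod 2) :
    (Wreath.entry (H := G.ker) (toWreathKer ht ht' g) i).1 =
      transversal t i * g * (transversal t (i + (G.deg g).toAdd))⁻¹ := rfl

/-- The upper left entry of a homomorphism to a wreath product, on the kernel of the degree. -/
def Hom.onKer {P : FibredGroup} (hP : P.TrivialDeg) (θ : Hom G P.wreath) : Hom G.ker P where
  toFun g := Wreath.entry (H := P) (θ g.1) 0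
  map_one' := congrArg (fun z => Wreath.entry (H := P) z 0) (map_one θ)
  map_mul' x y := by
    have h : Wreath.shift (H := P) (θ x.1) = 0 := (θ.deg_map x.1).trans x.2
    refine (congrArg (fun z => Wreath.entry (H := P) z 0) (map_mul θ x.1 y.1)).trans ?_
    change _ * Wreath.entry (H := P) (θ y.1) (0 + Wreath.shift (H := P) (θ x.1)) = _
    rw [h, add_zero]
  map_fibre' := congrArg (fun z => Wreath.entry (H := P) z 0) θ.map_fibre
  deg_map' x := hP _

/-- A homomorphism to a wreath product that is normalized at `t`, in the sense that the upper right
entry of the image of `t` is `1`, is determined by its upper left entry on the kernel. -/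
theorem Hom.onKer_wreath_comp {P : FibredGroup} (hP : P.TrivialDeg) (θ : Hom G P.wreath)
    (ht : G.deg t = odd) (ht' : Commute t G.fibre) (hθ : Wreath.entry (H := P) (θ t) 0 = 1) :
    (θ.onKer hP).wreath.comp (toWreathKer ht ht') = θ := by
  have hτ : ∀ i, Wreath.entry (H := P) (θ (transversal t i)) 0 = 1 :=
    Wreath.forall_zmod_two.2 ⟨congrArg (fun z => Wreath.entry (H := P) z 0) (map_one θ), hθ⟩
  have hs : ∀ x, Wreath.shift (H := P) (θ x) = (G.deg x).toAdd := fun x => θ.deg_map x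
  have hs' : ∀ i, Wreath.shift (H := P) (θ (transversal t i)) = i := fun i => by
    rw [hs, deg_transversal ht]; rfl
  ext g
  refine Wreath.ext (funext fun i => ?_) (hs g).symm
  change Wreath.entry (H := P)
    (θ (transversal t i * g * (transversal t (i + (G.deg g).toAdd))⁻¹)) 0 = _
  refine (congrArg (fun z => Wreath.entry (H := P) z 0) (show _ =
    θ (transversal t i) * θ g * (θ (transversal t (i + (G.deg g).toAdd)))⁻¹ by
      rw [map_mul, map_mul, map_inv])).trans ?_
  change Wreath.entry (H := P) (θ (transversal t i)) 0 *
    Wreath.entry (H := P) (θ g) (0 + Wreath.shift (H := P) (θ (transversal t i))) *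
    (Wreath.entry (H := P) (θ (transversal t (i + (G.deg g).toAdd)))
      (0 + (Wreath.shift (H := P) (θ (transversal t i)) + Wreath.shift (H := P) (θ g)) -
        Wreath.shift (H := P) (θ (transversal t (i + (G.deg g).toAdd)))))⁻¹ = _
  rw [hτ, hs', hs', hs, one_mul, zero_add, zero_add, sub_self, hτ, inv_one, mul_one]

end FibredGroup

namespace Block

variable {a b c d : ℤ} {C A B : Block}

/-- A solution with normalized first matrix, as a solution in the wreath product. -/
def ofNormalized {H : FibredGroup}
    (y : ((normalizedOddPair a b c d).tensor (ofWreath C)).Sol H) :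
    ((oddPair a b c d).tensor C).Sol H.wreath := (y.1.1, y.2)

theorem val_ofNormalized {H : FibredGroup}
    (y : ((normalizedOddPair a b c d).tensor (ofWreath C)).Sol H) :
    ((normalizedOddPair a b c d).tensor (ofWreath C)).val y =
      (Wreath.entry (H := H) (((oddPair a b c d).tensor C).val (ofNormalized y)) 0,
        Wreath.entry (H := H) (((oddPair a b c d).tensor C).val (ofNormalized y)) 1) := by
  have h := DegZero.shift (degZero_oddPair a b c d) (H := H) y.1.1
  have h' : ∀ i, Wreath.entry (H := H) (((oddPair a b c d).tensor C).val (ofNormalized y)) i =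
      Wreath.entry (H := H) ((oddPair a b c d).val y.1.1) i *
        Wreath.entry (H := H) (C.val y.2) i := by
    intro i
    change _ * Wreath.entry (H := H) (C.val y.2)
      (i + Wreath.shift (H := H) ((oddPair a b c d).val y.1.1)) = _
    rw [h, add_zero]
    rfl
  exact Prod.ext (h' 0).symm (h' 1).symm

/-- A group is presented by two branched fibres `s`, `s'` and a block `C`. If the normalized
solutions of these blocks in wreath products are equivalent to triples of a factorization of a
value `ω` of `A` as `Y X` and two solutions of `B` with values `u`, `u'`, then the kernel of the
degree is presented by `A` and two copies of `B`: the two rows of the long relator are `X u = 1` and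
`ω X⁻¹ u' = 1`, and eliminating `X` leaves `ω u u' = 1`. -/
theorem presents_ker
    (e : PairBlock.Iso ((normalizedOddPair a b c d).tensor (ofWreath C))
      ((factored A).tensor (double B)))
    (hC : C.DegZero) {G : FibredGroup} {x : ((oddPair a b c d).tensor C).Sol G}
    (hx : ((oddPair a b c d).tensor C).Presents G x) {P : FibredGroup} (hP : P.TrivialDeg)
    {z : (A.tensor (B.tensor B)).Sol P} (hz : (A.tensor (B.tensor B)).Presents P z) :
    Nonempty (G.deg.ker ≃* P) := by
  -- The bijection between normalized solutions and solutions of the new block.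
  let fwd : ∀ {H : FibredGroup}, H.TrivialDeg →
      ((normalizedOddPair a b c d).tensor (ofWreath C)).Sol H → (A.tensor (B.tensor B)).Sol H :=
    fun hH y => ((e.toFun hH y).1.1, (e.toFun hH y).2.1, (e.toFun hH y).2.2)
  let bwd : ∀ {H : FibredGroup}, H.TrivialDeg →
      (A.tensor (B.tensor B)).Sol H → ((normalizedOddPair a b c d).tensor (ofWreath C)).Sol H :=
    fun hH w => e.invFun hH ((w.1, ⟨(B.val w.2.1)⁻¹, (B.val_comm w.2.1).inv_left⟩), w.2)
  have val_fwd : ∀ {H : FibredGroup} (hH : H.TrivialDeg) y,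
      ((normalizedOddPair a b c d).tensor (ofWreath C)).val y = 1 →
        (A.tensor (B.tensor B)).val (fwd hH y) = 1 := by
    intro H hH y hy
    rw [← e.val_toFun hH] at hy
    have h₁ : (e.toFun hH y).1.2.1 * B.val (e.toFun hH y).2.1 = 1 := congrArg Prod.fst hy
    have h₂ : A.val (e.toFun hH y).1.1 * (e.toFun hH y).1.2.1⁻¹ * B.val (e.toFun hH y).2.2 = 1 :=
      congrArg Prod.snd hy
    rw [inv_eq_of_mul_eq_one_right h₁, mul_assoc] at h₂
    exact h₂
  have val_bwd : ∀ {H : FibredGroup} (hH : H.TrivialDeg) w, (A.tensor (B.tensor B)).val w = 1 →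
      ((normalizedOddPair a b c d).tensor (ofWreath C)).val (bwd hH w) = 1 := by
    intro H hH w hw
    refine (e.val_invFun hH _).trans (Prod.ext ?_ ?_)
    · exact inv_mul_cancel (B.val w.2.1)
    · change A.val w.1 * (B.val w.2.1)⁻¹⁻¹ * B.val w.2.2 = 1
      rw [inv_inv, mul_assoc]
      exact hw
  have fwd_bwd : ∀ {H : FibredGroup} (hH : H.TrivialDeg) w, fwd hH (bwd hH w) = w := by
    exact fun {H} hH w => congrArg (fun u : ((factored A).tensor (double B)).Sol H =>
      ((u.1.1, u.2.1, u.2.2) : (A.tensor (B.tensor B)).Sol H)) (e.right_inv hH _)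
  have bwd_fwd : ∀ {H : FibredGroup} (hH : H.TrivialDeg) y,
      ((normalizedOddPair a b c d).tensor (ofWreath C)).val y = 1 →
        bwd hH (fwd hH y) = y := by
    intro H hH y hy
    rw [← e.val_toFun hH] at hy
    have h₁ : (e.toFun hH y).1.2.1 * B.val (e.toFun hH y).2.1 = 1 := congrArg Prod.fst hy
    refine Eq.trans ?_ (e.left_inv hH y)
    refine congrArg (e.invFun hH) (Prod.ext (Prod.ext rfl (Subtype.ext ?_)) rfl)
    exact (eq_inv_of_mul_eq_one_left h₁).symm
  have map_fwd : ∀ {H K : FibredGroup} (hH : H.TrivialDeg) (hK : K.TrivialDeg) (f : Hom H K) y,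
      fwd hK (((normalizedOddPair a b c d).tensor (ofWreath C)).map f y) =
        (A.tensor (B.tensor B)).map f (fwd hH y) := by
    exact fun {H K} hH hK f y => congrArg (fun u : ((factored A).tensor (double B)).Sol K =>
      ((u.1.1, u.2.1, u.2.2) : (A.tensor (B.tensor B)).Sol K)) (e.map_toFun hH hK f y)
  have map_bwd : ∀ {H K : FibredGroup} (hH : H.TrivialDeg) (hK : K.TrivialDeg) (f : Hom H K) w,
      bwd hK ((A.tensor (B.tensor B)).map f w) =
        ((normalizedOddPair a b c d).tensor (ofWreath C)).map f (bwd hH w) := by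
    intro H K hH hK f w
    refine Eq.trans ?_ (e.map_invFun hH hK f _)
    refine congrArg (e.invFun hK) (Prod.ext (Prod.ext rfl (Subtype.ext ?_)) rfl)
    change (B.val (B.map f w.2.1))⁻¹ = f (B.val w.2.1)⁻¹
    rw [B.val_map, map_inv]
  -- The element `t` and the solution in the wreath product of the kernel.
  have ht : G.deg x.1.1.1 = odd := x.1.1.2.1.1
  have ht' : Commute x.1.1.1 G.fibre := x.1.1.2.1.commute rfl
  have hK := G.trivialDeg_ker
  let ι := toWreathKer ht ht'
  let y : ((normalizedOddPair a b c d).tensor (ofWreath C)).Sol G.ker :=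
    (⟨(oddPair a b c d).map ι x.1, by
      apply Subtype.ext
      refine (toWreathKer_entry ht ht' _ 0).trans ?_
      rw [ht]
      change 1 * x.1.1.1 * x.1.1.1⁻¹ = 1
      group⟩, C.map ι x.2)
  have hy : ((normalizedOddPair a b c d).tensor (ofWreath C)).val y = 1 := by
    have h : ((oddPair a b c d).tensor C).val (ofNormalized y) = 1 := by
      refine (((oddPair a b c d).tensor C).val_map ι x).trans ?_
      rw [hx.val_eq_one, map_one]
    rw [val_ofNormalized, h]
    rfl
  obtain ⟨ψ, hψ⟩ := hz.exists_hom (fwd hK y) (val_fwd hK y hy)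
  -- The solution in the wreath product of `P`.
  have hw := val_bwd hP z hz.val_eq_one
  obtain ⟨θ, hθ⟩ := hx.exists_hom (ofNormalized (bwd hP z)) (by
    rw [val_ofNormalized] at hw
    refine Wreath.ext_iff_two.2 ⟨congrArg Prod.fst hw, congrArg Prod.snd hw, ?_⟩
    exact DegZero.shift (DegZero.tensor (degZero_oddPair a b c d) hC) (H := P)
      (ofNormalized (bwd hP z)))
  have hθt : Wreath.entry (H := P) (θ x.1.1.1) 0 = 1 := by
    have h : θ x.1.1.1 = (bwd hP z).1.1.1.1 := congrArg (fun w => w.1.1.1) hθ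
    rw [h]
    exact (bwd hP z).1.2
  have h₁ : ψ.wreath.comp θ = ι := by
    apply hx.hom_ext
    rw [Block.map_comp, hθ]
    change ofNormalized (((normalizedOddPair a b c d).tensor (ofWreath C)).map ψ (bwd hP z)) =
      ofNormalized y
    rw [← map_bwd hP hK, hψ, bwd_fwd hK y hy]
  have h₂ : (θ.onKer hP).comp ψ = Hom.id P := by
    apply hz.hom_ext
    rw [Block.map_comp, hψ, ← map_fwd hK hP, Block.map_id]
    refine Eq.trans ?_ (fwd_bwd hP z)
    congr 1
    have h : ofNormalized (((normalizedOddPair a b c d).tensor (ofWreath C)).map (θ.onKer hP) y) =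
        ofNormalized (bwd hP z) := by
      rw [← hθ]
      change ((oddPair a b c d).tensor C).map (θ.onKer hP).wreath
        (((oddPair a b c d).tensor C).map ι x) = _
      rw [← Block.map_comp, Hom.onKer_wreath_comp hP θ ht ht' hθt]
    exact Prod.ext (Subtype.ext (congrArg (fun w => w.1) h)) (congrArg (fun w => w.2) h)
  refine ⟨MonoidHom.toMulEquiv (θ.onKer hP).toMonoidHom ψ.toMonoidHom ?_ ?_⟩
  · ext g
    have h := congrArg (fun f : Hom G G.ker.wreath => Wreath.entry (H := G.ker) (f g.1) 0) h₁
    change ψ (Wreath.entry (H := P) (θ g.1) 0) = _ at h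
    change Subtype.val (ψ (Wreath.entry (H := P) (θ g.1) 0)) = g.1
    rw [h]
    refine (toWreathKer_entry ht ht' g.1 0).trans ?_
    rw [MonoidHom.mem_ker.1 g.2]
    change 1 * g.1 * 1⁻¹ = g.1
    group
  · ext p
    exact DFunLike.congr_fun h₂ p

end Block

/-! ### Normal forms of the blocks -/

namespace Block

theorem eq_one_or_eq_odd (d : Multiplicative (ZMod 2)) : d = 1 ∨ d = odd := by
  revert d
  decide

theorem exists_slide_handle_left (τ σ : ElementType) :
    ∃ η : ℤˣ, (σ.2 = 1 → η = 1) ∧ ∀ a b, (coneBlock odd a b).cls * (handle τ σ).cls =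
      (coneBlock odd a (η * b)).cls * (handle (1, τ.2) σ).cls := by
  obtain ⟨d, ε⟩ := τ
  rcases eq_one_or_eq_odd d with rfl | rfl
  · exact ⟨1, fun _ => rfl, fun a b => by rw [Units.val_one, one_mul]⟩
  · refine ⟨σ.2, id, fun a b => ?_⟩
    rw [cls_coneBlock_mul_handle, mul_comm]
    congr 3
    exact Prod.ext (by decide : odd * odd = 1) (one_mul ε)

/-- Sliding an exceptional fibre of odd degree makes the degrees of a handle trivial. -/
theorem exists_slide_handle (τ σ : ElementType) :
    ∃ η : ℤˣ, (τ.2 = 1 ∧ σ.2 = 1 → η = 1) ∧ ∀ a b, (coneBlock odd a b).cls * (handle τ σ).cls =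
      (coneBlock odd a (η * b)).cls * (handle (1, τ.2) (1, σ.2)).cls := by
  obtain ⟨η, hη, h⟩ := exists_slide_handle_left τ σ
  obtain ⟨η', hη', h'⟩ := exists_slide_handle_left σ (1, τ.2)
  refine ⟨η' * η, fun ⟨h₁, h₂⟩ => by rw [hη h₂, hη' h₁, one_mul], fun a b => ?_⟩
  rw [h, cls_handle_comm, h', cls_handle_comm, Units.val_mul, mul_assoc]

/-- Sliding an exceptional fibre of odd degree makes the degree of a cross-cap trivial. -/
theorem exists_slide_crosscap (τ : ElementType) :
    ∃ η : ℤˣ, (τ.2 = -1 → η = 1) ∧ ∀ a b, (coneBlock odd a b).cls * (crosscap τ).cls =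
      (coneBlock odd a (η * b)).cls * (crosscap (1, τ.2)).cls := by
  obtain ⟨d, ε⟩ := τ
  rcases eq_one_or_eq_odd d with rfl | rfl
  · exact ⟨1, fun _ => rfl, fun a b => by rw [Units.val_one, one_mul]⟩
  · refine ⟨-ε, fun (h : ε = -1) => by rw [h, neg_neg], fun a b => ?_⟩
    rw [cls_coneBlock_mul_crosscap, mul_comm]
    congr 3
    · simp
    · exact Prod.ext (by decide : odd * odd = 1) (one_mul ε)

theorem exists_slide_ofFn {p : Prop} {n : ℕ} {X X' : Fin n → BlockClass} {Y Y' : BlockClass}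
    (hY : Y = (List.ofFn X).prod) (hY' : Y' = (List.ofFn X').prod)
    (h : ∀ i, ∃ η : ℤˣ, (p → η = 1) ∧ ∀ a b, (coneBlock odd a b).cls * X i =
      (coneBlock odd a (η * b)).cls * X' i) :
    ∃ η : ℤˣ, (p → η = 1) ∧ ∀ a b, (coneBlock odd a b).cls * Y =
      (coneBlock odd a (η * b)).cls * Y' := by
  subst hY hY'
  induction n with
  | zero => exact ⟨1, fun _ => rfl, fun a b => by simp⟩
  | succ n ih =>
    obtain ⟨η, hη, h₀⟩ := h 0
    obtain ⟨η', hη', h₁⟩ := ih (fun i => h i.succ)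
    refine ⟨η' * η, fun hp => by rw [hη hp, hη' hp, one_mul], fun a b => ?_⟩
    rw [List.ofFn_succ, List.ofFn_succ, List.prod_cons, List.prod_cons, ← mul_assoc, h₀,
      mul_right_comm, h₁, mul_right_comm, mul_assoc, Units.val_mul, mul_assoc]

/-- The block of a surface all of whose generators have trivial degree. -/
def evenSurface (t : SeifertType) (g : ℕ) : Block :=
  surface t g fun j => (1, t.signUnit j)

/-- Sliding an exceptional fibre of odd degree along the surface makes all degrees trivial. -/
theorem exists_slide_surface (t : SeifertType) (g : ℕ)
    (d : Fin (t.numV g) → Multiplicative (ZMod 2)) :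
    ∃ η : ℤˣ, (t = .o1 ∨ t = .n2 → η = 1) ∧ ∀ a b,
      (coneBlock odd a b).cls * (surface t g fun j => (d j, t.signUnit j)).cls =
      (coneBlock odd a (η * b)).cls * (evenSurface t g).cls := by
  unfold evenSurface
  cases t
  · refine exists_slide_ofFn (cls_surface_o1 g _) (cls_surface_o1 g _) fun i => ?_
    obtain ⟨η, hη, h⟩ := exists_slide_handle _ _
    exact ⟨η, fun _ => hη ⟨rfl, rfl⟩, h⟩
  · refine exists_slide_ofFn (cls_surface_o2 g _) (cls_surface_o2 g _) fun i => ?_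
    obtain ⟨η, hη, h⟩ := exists_slide_handle _ _
    exact ⟨η, by simp, h⟩
  · refine exists_slide_ofFn (cls_surface_n1 g _) (cls_surface_n1 g _) fun i => ?_
    obtain ⟨η, hη, h⟩ := exists_slide_crosscap _
    exact ⟨η, by simp, h⟩
  · refine exists_slide_ofFn (cls_surface_n2 g _) (cls_surface_n2 g _) fun i => ?_
    obtain ⟨η, hη, h⟩ := exists_slide_crosscap _
    exact ⟨η, fun _ => hη rfl, h⟩
  · refine exists_slide_ofFn (cls_surface_n3 g _) (cls_surface_n3 g _) fun i => ?_
    obtain ⟨η, hη, h⟩ := exists_slide_crosscap _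
    exact ⟨η, by simp, h⟩
  · refine exists_slide_ofFn (cls_surface_n4 g _) (cls_surface_n4 g _) fun i => ?_
    obtain ⟨η, hη, h⟩ := exists_slide_crosscap _
    exact ⟨η, by simp, h⟩

/-- The type of the elements of trivial degree that invert the fibre. -/
abbrev inverting : ElementType := (1, -1)

theorem cls_evenSurface_o1 (g : ℕ) : (evenSurface .o1 g).cls = (handle 1 1).cls ^ g := by
  refine (cls_surface_o1 g _).trans ?_
  exact (List.prod_eq_pow_card _ (handle 1 1).cls (by simp; exact fun _ => rfl)).trans (by simp)

theorem cls_evenSurface_o2 (g : ℕ) :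
    (evenSurface .o2 g).cls = (handle inverting inverting).cls ^ g := by
  refine (cls_surface_o2 g _).trans ?_
  exact (List.prod_eq_pow_card _ (handle inverting inverting).cls
    (by simp; exact fun _ => rfl)).trans (by simp)

theorem cls_evenSurface_n1 (g : ℕ) : (evenSurface .n1 g).cls = (crosscap 1).cls ^ g := by
  refine (cls_surface_n1 g _).trans ?_
  exact (List.prod_eq_pow_card _ (crosscap 1).cls (by simp; exact fun _ => rfl)).trans (by simp)

theorem cls_evenSurface_n2 (g : ℕ) :
    (evenSurface .n2 g).cls = (crosscap inverting).cls ^ g := by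
  refine (cls_surface_n2 g _).trans ?_
  exact (List.prod_eq_pow_card _ (crosscap inverting).cls
    (by simp; exact fun _ => rfl)).trans (by simp)

theorem cls_evenSurface_n3 (g : ℕ) :
    (evenSurface .n3 (g + 1)).cls = (crosscap 1).cls * (crosscap inverting).cls ^ g := by
  refine (cls_surface_n3 (g + 1) _).trans ?_
  rw [List.ofFn_succ, List.prod_cons]
  refine congrArg₂ (· * ·) rfl ?_
  exact (List.prod_eq_pow_card _ (crosscap inverting).cls
    (by simp; exact fun _ => rfl)).trans (by simp)

theorem cls_evenSurface_n4 (g : ℕ) :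
    (evenSurface .n4 (g + 2)).cls = (crosscap 1).cls ^ 2 * (crosscap inverting).cls ^ g := by
  refine (cls_surface_n4 (g + 2) _).trans ?_
  rw [List.ofFn_succ, List.prod_cons, List.ofFn_succ, List.prod_cons, ← mul_assoc, pow_two]
  refine congrArg₂ (· * ·) rfl ?_
  refine (List.prod_eq_pow_card _ (crosscap inverting).cls ?_).trans (by simp)
  intro x hx
  obtain ⟨i, rfl⟩ := List.mem_ofFn.1 hx
  have : SeifertType.n4.signUnit (i.val + 1 + 1) = -1 := by
    simp [SeifertType.signUnit, SeifertType.sign]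
  exact congrArg (fun ε => (crosscap (1, ε)).cls) this

/-- In the presence of a handle or a cross-cap that reverses the orientation of the total space,
even powers of the fibre and the signs of the exceptional fibres do not matter. -/
theorem absorb_evenSurface {t : SeifertType} {g : ℕ} (hg : t.minGenus ≤ g)
    (ht : ¬ (t = .o1 ∨ t = .n2)) :
    (euler 2).cls * (evenSurface t g).cls = (evenSurface t g).cls ∧
    ∀ a b, (coneBlock 1 a (-b)).cls * (evenSurface t g).cls =
      (coneBlock 1 a b).cls * (evenSurface t g).cls := by
  have of_dvd : ∀ {X Z : BlockClass}, (euler 2).cls * X = X →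
      (∀ a b, (coneBlock 1 a (-b)).cls * X = (coneBlock 1 a b).cls * X) →
      (euler 2).cls * (X * Z) = X * Z ∧
        ∀ a b, (coneBlock 1 a (-b)).cls * (X * Z) = (coneBlock 1 a b).cls * (X * Z) := by
    intro X Z h h'
    exact ⟨by rw [← mul_assoc, h], fun a b => by rw [← mul_assoc, h', mul_assoc]⟩
  have hQ : ∀ a b, (coneBlock 1 a (-b)).cls * (crosscap 1).cls =
      (coneBlock 1 a b).cls * (crosscap 1).cls := by
    intro a b
    rw [cls_coneBlock_mul_crosscap, mul_comm]
    congr 3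
    simp
  have hH : ∀ a b, (coneBlock 1 a (-b)).cls * (handle inverting inverting).cls =
      (coneBlock 1 a b).cls * (handle inverting inverting).cls := by
    intro a b
    rw [cls_coneBlock_mul_handle, mul_comm]
    congr 3
    simp
  have hQ' := cls_euler_two_mul_crosscap 1 rfl
  have hH' := cls_euler_two_mul_handle inverting inverting rfl
  cases t
  · exact absurd (Or.inl rfl) ht
  · obtain ⟨k, rfl⟩ := Nat.exists_eq_add_of_le' hg
    rw [cls_evenSurface_o2, SeifertType.minGenus, pow_succ']
    exact of_dvd hH' hH
  · obtain ⟨k, rfl⟩ := Nat.exists_eq_add_of_le' hg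
    rw [cls_evenSurface_n1, SeifertType.minGenus, pow_succ']
    exact of_dvd hQ' hQ
  · exact absurd (Or.inr rfl) ht
  · obtain ⟨k, rfl⟩ := Nat.exists_eq_add_of_le' hg
    rw [SeifertType.minGenus, cls_evenSurface_n3]
    exact of_dvd hQ' hQ
  · obtain ⟨k, rfl⟩ := Nat.exists_eq_add_of_le' hg
    rw [SeifertType.minGenus, cls_evenSurface_n4 (k + 1), pow_two, mul_assoc]
    exact of_dvd hQ' hQ

theorem cls_handle_pow_mul_crosscap (τ : ElementType) (j : ℕ) :
    (handle 1 1).cls ^ j * (crosscap τ).cls = (crosscap τ).cls ^ (2 * j + 1) := by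
  induction j with
  | zero => simp
  | succ j ih =>
    rw [pow_succ', mul_assoc, ih, pow_succ', ← mul_assoc, cls_handle_mul_crosscap]
    simp only [← pow_succ', ← pow_two, ← pow_add]
    ring_nf

theorem cls_handle_mul_inverting :
    (handle 1 1).cls * (handle inverting inverting).cls =
      (handle inverting inverting).cls * (handle inverting inverting).cls := by
  have h : (handle inverting 1).cls = (handle inverting inverting).cls := by
    rw [cls_handle_comm, cls_handle_mul, one_mul]
  rw [cls_handle_mul_handle, one_mul, one_mul, ElementType.mul_self, h]

theorem cls_handle_pow_mul_inverting (j : ℕ) :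
    (handle 1 1).cls ^ j * (handle inverting inverting).cls =
      (handle inverting inverting).cls ^ (j + 1) := by
  induction j with
  | zero => simp
  | succ j ih =>
    rw [pow_succ', mul_assoc, ih, pow_succ', ← mul_assoc, cls_handle_mul_inverting, mul_assoc,
      ← pow_succ', ← pow_succ']

/-- On a surface with a cross-cap whose core inverts the fibre, two of the other kind can be
traded for two of the same kind, as long as two more are present. -/
theorem cls_crosscap_trade :
    (crosscap 1).cls ^ 4 * (crosscap inverting).cls =
      (crosscap 1).cls ^ 2 * (crosscap inverting).cls ^ 3 := by
  have h₁ := cls_handle_pow_mul_crosscap 1 1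
  have h₂ := cls_handle_pow_mul_crosscap inverting 1
  norm_num at h₁ h₂
  rw [pow_succ, ← h₁, ← h₂]
  simp only [pow_two, mul_assoc, mul_comm, mul_left_comm]

/-- Two copies of the surface, joined by `j` handles. -/
theorem cls_handle_pow_mul_evenSurface_sq {S : SeifertData} (hS : S.type.minGenus ≤ S.g)
    (j : ℕ) :
    (handle 1 1).cls ^ j * ((evenSurface S.type S.g).cls * (evenSurface S.type S.g).cls) =
      (evenSurface S.coverType (S.coverG (2 * (j + 1)))).cls := by
  obtain ⟨e, t, g, l⟩ := S
  change t.minGenus ≤ g at hS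
  change _ * ((evenSurface t g).cls * (evenSurface t g).cls) = _
  cases t
  · change _ = (evenSurface .o1 (2 * (j + 1) / 2 - 1 + 2 * g)).cls
    rw [cls_evenSurface_o1, cls_evenSurface_o1, ← pow_add, ← pow_add]
    congr 1
    omega
  · change _ = (evenSurface .o2 (2 * (j + 1) / 2 - 1 + 2 * g)).cls
    obtain ⟨k, rfl⟩ := Nat.exists_eq_add_of_le' hS
    rw [cls_evenSurface_o2, cls_evenSurface_o2, SeifertType.minGenus, ← pow_add]
    rw [show k + 1 + (k + 1) = 1 + (2 * k + 1) by omega, pow_add, pow_one, ← mul_assoc,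
      cls_handle_pow_mul_inverting, ← pow_add]
    congr 1
    omega
  · change _ = (evenSurface .n1 (2 * (j + 1) - 2 + 2 * g)).cls
    obtain ⟨k, rfl⟩ := Nat.exists_eq_add_of_le' hS
    rw [cls_evenSurface_n1, cls_evenSurface_n1, SeifertType.minGenus, ← pow_add]
    rw [show k + 1 + (k + 1) = 1 + (2 * k + 1) by omega, pow_add, pow_one, ← mul_assoc,
      cls_handle_pow_mul_crosscap, ← pow_add]
    congr 1
    omega
  · change _ = (evenSurface .n2 (2 * (j + 1) - 2 + 2 * g)).cls
    obtain ⟨k, rfl⟩ := Nat.exists_eq_add_of_le' hS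
    rw [cls_evenSurface_n2, cls_evenSurface_n2, SeifertType.minGenus, ← pow_add]
    rw [show k + 1 + (k + 1) = 1 + (2 * k + 1) by omega, pow_add, pow_one, ← mul_assoc,
      cls_handle_pow_mul_crosscap, ← pow_add]
    congr 1
    omega
  · change _ = (evenSurface .n4 (2 * (j + 1) - 2 + 2 * g)).cls
    obtain ⟨k, rfl⟩ := Nat.exists_eq_add_of_le' hS
    rw [SeifertType.minGenus, cls_evenSurface_n3 (k + 1),
      show 2 * (j + 1) - 2 + 2 * (k + 2) = (2 * j + 1 + (2 * k + 1)) + 2 by omega,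
      cls_evenSurface_n4, pow_add _ (2 * j + 1), ← cls_handle_pow_mul_crosscap, pow_two]
    rw [show 2 * k + 1 = k + (k + 1) by omega, pow_add _ k (k + 1), pow_succ]
    simp only [mul_assoc, mul_comm, mul_left_comm]
  · change _ = (evenSurface .n4 (2 * (j + 1) - 2 + 2 * g)).cls
    obtain ⟨k, rfl⟩ := Nat.exists_eq_add_of_le' hS
    rw [SeifertType.minGenus, cls_evenSurface_n4 (k + 1),
      show 2 * (j + 1) - 2 + 2 * (k + 3) = (3 + (2 * j + (2 * k + 1))) + 2 by omega,
      cls_evenSurface_n4, pow_add _ 3, ← mul_assoc (_ ^ 2) (_ ^ 3), ← cls_crosscap_trade]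
    have h := cls_handle_pow_mul_crosscap inverting j
    calc _ = (crosscap 1).cls ^ 4 * ((handle 1 1).cls ^ j * (crosscap inverting).cls) *
          (crosscap inverting).cls ^ (2 * k + 1) := by
          rw [mul_mul_mul_comm, ← pow_add, ← pow_add, mul_left_comm, mul_assoc, mul_assoc,
            ← pow_succ', show k + 1 + (k + 1) = 2 * k + 1 + 1 by omega]
      _ = _ := by
          rw [h, mul_assoc, mul_assoc, ← pow_add, ← pow_succ']
          congr 2
          omega

end Block

/-! ### The double cover of a Seifert manifold -/

namespace Block

theorem exists_pairs {α : Type*} : ∀ l : List α, Even l.length →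
    ∃ l' : List (α × α), l = l'.flatMap fun p => [p.1, p.2]
  | [], _ => ⟨[], rfl⟩
  | [_], h => absurd h (by simp)
  | x :: y :: l, h => by
    obtain ⟨l', hl'⟩ := exists_pairs l (by simpa [Nat.even_add_one] using h)
    exact ⟨(x, y) :: l', by rw [List.flatMap_cons, ← hl']; rfl⟩

theorem prod_map_flatMap_pair {α β M : Type*} [CommMonoid M] (l : List α) (u v : α → β)
    (f : β → M) : ((l.flatMap fun p => [u p, v p]).map f).prod =
      (l.map fun p => f (u p) * f (v p)).prod := by
  induction l with
  | nil => rfl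
  | cons p l ih => simp [← ih, mul_assoc]

theorem DegZero.list {l : List Block} (hl : ∀ A ∈ l, A.DegZero) : (Block.list l).DegZero := by
  induction l with
  | nil => exact degZero_one
  | cons A l ih =>
    exact DegZero.tensor (hl A (by simp)) (ih fun B hB => hl B (by simp [hB]))

/-- The rearrangement that slides a factor `x` past `u` in a product. -/
theorem mul_slide {M : Type*} [CommMonoid M] {x x' u u' : M} (h : x * u = x' * u')
    (e y p d : M) : e * (x * y * p * d * u) = x' * y * (p * (e * (d * u'))) := by
  calc e * (x * y * p * d * u) = (x * u) * (e * (y * p * d)) := by ac_rfl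
    _ = _ := by
      rw [h]
      ac_rfl

/-- The rearrangement that compares the block of the kernel, where the unbranched part occurs twice,
with the block of the double cover. -/
theorem mul_double {M : Type*} [CommMonoid M] {k u v x x' e e' : M} (hv : k * (u * u) = v)
    (hx : x' * (e * e * v) = x * (e' * v)) (y p d : M) :
    e' * (x * y * p * (d * d) * v) =
      x' * y * (p * k) * (e * (d * u) * (e * (d * u))) := by
  calc e' * (x * y * p * (d * d) * v) = (x * (e' * v)) * (y * p * (d * d)) := by ac_rfl
    _ = _ := by
      rw [← hx, ← hv]
      ac_rfl

theorem cls_euler_mul_of_two {X : BlockClass} (h : (euler 2).cls * X = X) (k : ℤ) :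
    (euler (2 * k)).cls * X = X := by
  have hn : ∀ n : ℕ, (euler (2 * n)).cls * X = X := by
    intro n
    induction n with
    | zero => simp [cls_euler_zero]
    | succ n ih => rw [Nat.cast_succ, mul_add_one, cls_euler_add, mul_assoc, h, ih]
  obtain ⟨n, rfl | rfl⟩ := k.eq_nat_or_neg
  · exact hn n
  · conv_lhs => rw [← hn n, ← mul_assoc, ← cls_euler_add]
    simp [cls_euler_zero]

end Block

namespace SeifertData

theorem cls_block (S : SeifertData) (d : Fin S.n → Multiplicative (ZMod 2))
    (d' : Fin S.g' → Multiplicative (ZMod 2)) :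
    (S.block d d').cls = (euler (-S.e)).cls *
      ((List.ofFn fun k => (coneBlock (d k) (S.a k) (S.b k)).cls).prod *
        (surface S.type S.g fun j => (d' j, S.type.signUnit j)).cls) := by
  rw [block, cls_tensor, cls_tensor, cls_pi]

theorem ofFn_coneBlock (S : SeifertData) :
    (List.ofFn fun k => (coneBlock 1 (S.a k) (S.b k)).cls) =
      S.fibres.map fun p => (coneBlock 1 p.1 p.2).cls := by
  apply List.ext_getElem <;> simp [a, b]

/-- A family indexed by the exceptional fibres, as a list, when the first `m` generators have degree
`1` and the others have degree `0`. -/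
theorem ofFn_deg (S : SeifertData) {m : ℕ} (hmn : m ≤ S.n)
    {d : Fin S.n → Multiplicative (ZMod 2)} (h₁ : ∀ k : Fin S.n, k.val < m → d k = odd)
    (h₀ : ∀ k : Fin S.n, m ≤ k.val → d k = 1) {M : Type*}
    (f : Multiplicative (ZMod 2) → ℤ × ℤ → M) :
    (List.ofFn fun k => f (d k) (S.a k, S.b k)) =
      (S.fibres.take m).map (f odd) ++ (S.fibres.drop m).map (f 1) := by
  have hn : S.fibres.length = S.n := rfl
  apply List.ext_getElem
  · simp only [List.length_ofFn, List.length_append, List.length_map, List.length_take,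
      List.length_drop]
    omega
  · intro i hi hi'
    simp only [List.length_ofFn] at hi
    rw [List.getElem_ofFn, List.getElem_append]
    split_ifs with h
    · have him : i < m := by
        simp only [List.length_map, List.length_take] at h
        omega
      rw [h₁ ⟨i, hi⟩ him]
      simp [a, b]
    · have him : m ≤ i := by
        simp only [List.length_map, List.length_take] at h
        omega
      rw [h₀ ⟨i, hi⟩ him]
      simp only [List.getElem_map, List.getElem_drop, List.length_map, List.length_take]
      have h' : m + (i - min m S.fibres.length) = i := by
        omega
      simp [a, b, h']

theorem minGenus_le_coverG {S : SeifertData} (hS : S.type.minGenus ≤ S.g) (j : ℕ) :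
    S.coverType.minGenus ≤ S.coverG (2 * (j + 1)) := by
  obtain ⟨e, t, g, l⟩ := S
  cases t <;> simp only [coverType, coverG, SeifertType.minGenus] at hS ⊢ <;> omega

/-- In the double cover, the sign of one exceptional fibre and the difference between `2 e` and `e'`
do not matter: either the sign is `1` and `e' = 2 e`, or the surface absorbs both. -/
theorem cls_coneBlock_mul_euler {S : SeifertData} (hS : S.type.minGenus ≤ S.g) (j : ℕ)
    {η : ℤˣ} (hη : S.type = .o1 ∨ S.type = .n2 → η = 1) (a b : ℤ) :
    (coneBlock 1 a (η * b)).cls * ((euler (-S.e)).cls * (euler (-S.e)).cls *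
        (evenSurface S.coverType (S.coverG (2 * (j + 1)))).cls) =
      (coneBlock 1 a b).cls * ((euler (-S.coverE)).cls *
        (evenSurface S.coverType (S.coverG (2 * (j + 1)))).cls) := by
  have h₂ : -S.e + -S.e = 2 * -S.e := by ring
  rw [← cls_euler_add, h₂]
  by_cases ht : S.type = .o1 ∨ S.type = .n2
  · have he : S.coverE = 2 * S.e := by
      unfold coverE
      rcases ht with h | h <;> rw [h]
    rw [hη ht, Units.val_one, one_mul, he, mul_neg]
  · have he : S.coverE = 0 := by
      unfold coverE
      cases h : S.type <;> simp [h] at ht ⊢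
    have ht' : ¬ (S.coverType = .o1 ∨ S.coverType = .n2) := by
      unfold coverType
      cases h : S.type <;> simp [h] at ht ⊢
    obtain ⟨h₁, h₂⟩ := absorb_evenSurface (minGenus_le_coverG hS j) ht'
    rw [he, neg_zero, cls_euler_zero, one_mul, cls_euler_mul_of_two h₁]
    rcases Int.units_eq_one_or η with rfl | rfl
    · rw [Units.val_one, one_mul]
    · rw [Units.val_neg, Units.val_one, neg_one_mul, h₂]

theorem even_of_deg {S : SeifertData} (φ : S.Pi1 →* Multiplicative (ZMod 2)) (hφh : φ S.h = 1)
    {k : Fin S.n} (hk : φ (S.s k) = odd) : Even (S.a k) := by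
  have h := congrArg φ (Relator.fibre k).mk_eq_one
  have h' : φ (S.s k) ^ S.a k * φ S.h ^ S.b k = 1 := by
    simp only [map_mul, map_zpow, map_one] at h
    exact h
  rw [hφh, one_zpow, mul_one, hk, ← ofAdd_zsmul, zsmul_one] at h'
  have h'' : ((S.a k : ℤ) : ZMod 2) = 0 := h'
  rw [ZMod.intCast_zmod_eq_zero_iff_dvd] at h''
  exact even_iff_two_dvd.2 h''

theorem even_card_of_deg {S : SeifertData} {m : ℕ} (hmn : m ≤ S.n)
    (φ : S.Pi1 →* Multiplicative (ZMod 2)) (hφh : φ S.h = 1)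
    (h₁ : ∀ k : Fin S.n, k.val < m → φ (S.s k) = odd)
    (h₀ : ∀ k : Fin S.n, m ≤ k.val → φ (S.s k) = 1) : Even m := by
  have h := congrArg φ (Relator.mk_eq_one (S := S) Relator.long)
  have h' : φ S.h ^ (-S.e) * (List.ofFn fun k => φ (S.s k)).prod *
      S.type.surfaceWord S.g (fun j => φ (S.v j)) = 1 := by
    simp only [map_mul, map_zpow, map_list_prod, List.map_ofFn, SeifertType.map_surfaceWord,
      map_one] at h
    exact h
  rw [hφh, one_zpow, one_mul, Block.surfaceWord_eq_one (by decide), mul_one,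
    S.ofFn_deg hmn h₁ h₀ (fun d _ => d), List.map_const', List.map_const',
    List.prod_append, List.prod_replicate, List.prod_replicate, one_pow, mul_one,
    List.length_take, min_eq_left hmn, ← ofAdd_nsmul, nsmul_one] at h'
  have h'' : (m : ZMod 2) = 0 := h'
  rwa [ZMod.natCast_eq_zero_iff_even] at h''

theorem even_of_mem_take {S : SeifertData} {m : ℕ} (hmn : m ≤ S.n)
    (ha : ∀ k : Fin S.n, k.val < m → Even (S.a k)) {q : ℤ × ℤ} (hq : q ∈ S.fibres.take m) :
    Even q.1 := by
  obtain ⟨i, hi, rfl⟩ := List.mem_iff_getElem.1 hq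
  have hi' : i < m := by
    simp only [List.length_take] at hi
    omega
  rw [List.getElem_take]
  exact ha ⟨i, hi'.trans_le hmn⟩ hi'

theorem isValid_cover {S : SeifertData} (hS : S.IsValid) {j : ℕ}
    (hmn : 2 * (j + 1) ≤ S.n)
    (ha : ∀ k : Fin S.n, k.val < 2 * (j + 1) → Even (S.a k)) :
    (S.cover (2 * (j + 1))).IsValid := by
  refine ⟨minGenus_le_coverG hS.1 j, fun p hp => ?_⟩
  rcases List.mem_append.1 hp with hp | hp
  · obtain ⟨q, hq, rfl⟩ := List.mem_map.1 hp
    obtain ⟨h₀, hc⟩ := hS.2 q (List.mem_of_mem_take hq)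
    obtain ⟨r, hr⟩ := even_iff_two_dvd.1 (even_of_mem_take hmn ha hq)
    rw [hr] at h₀ hc
    dsimp only
    rw [hr, Int.mul_ediv_cancel_left r two_ne_zero]
    exact ⟨right_ne_zero_of_mul h₀, hc.of_mul_left_right⟩
  · obtain ⟨q, hq, hp⟩ := List.mem_flatMap.1 hp
    obtain rfl : p = q := by simpa using hp
    exact hS.2 p (List.mem_of_mem_drop hq)

/-- The kernel of `φ` is the fundamental group of the double cover. -/
theorem ker_equiv_cover {S : SeifertData} (hS : S.IsValid) {m : ℕ} (hm : 0 < m)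
    (hmn : m ≤ S.n) (hm₂ : Even m)
    (ha : ∀ k : Fin S.n, k.val < m → Even (S.a k))
    (φ : S.Pi1 →* Multiplicative (ZMod 2)) (hφh : φ S.h = 1)
    (h₁ : ∀ k : Fin S.n, k.val < m → φ (S.s k) = odd)
    (h₀ : ∀ k : Fin S.n, m ≤ k.val → φ (S.s k) = 1) :
    Nonempty (φ.ker ≃* (S.cover m).Pi1) := by
  -- The branched fibres, grouped in pairs.
  obtain ⟨l, hl⟩ := exists_pairs ((S.fibres.take m).map fun p => (p.1 / 2, p.2)) (by
    rw [List.length_map, List.length_take, min_eq_left hmn]; exact hm₂)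
  have hlen : m = 2 * l.length := by
    have := congrArg List.length hl
    rw [List.length_map, List.length_take, min_eq_left hmn, List.length_flatMap] at this
    simp only [List.length_cons, List.length_nil, List.map_const', List.sum_replicate] at this
    rw [this, smul_eq_mul, mul_comm]
  have htake : S.fibres.take m = (l.flatMap fun p => [p.1, p.2]).map fun p => (2 * p.1, p.2) := by
    rw [← hl, List.map_map]
    symm
    refine (List.map_congr_left fun q hq => ?_).trans (List.map_id _)
    exact Prod.ext (Int.mul_ediv_cancel' (even_iff_two_dvd.1 (even_of_mem_take hmn ha hq))) rfl
  obtain _ | ⟨⟨⟨a, b⟩, ⟨c, d⟩⟩, l⟩ := l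
  · simp at hlen
    omega
  rw [List.length_cons] at hlen
  -- The fundamental group, with all degrees of the generators `v_j` made trivial.
  obtain ⟨η, hη, hslide⟩ := exists_slide_surface S.type S.g fun j => φ (S.v j)
  let D : Block := Block.list ((S.fibres.drop m).map fun p => coneBlock 1 p.1 p.2)
  let B : Block := (euler (-S.e)).tensor (D.tensor (evenSurface S.type S.g))
  let R : Block := Block.list (l.map fun p => oddPair p.1.1 p.1.2 p.2.1 p.2.2)
  have hB : B.Splits := by
    refine (splits_euler _).tensor (Splits.tensor (Splits.list fun A hA => ?_)
      (splits_surface _ _ _ fun _ => rfl))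
    obtain ⟨p, -, rfl⟩ := List.mem_map.1 hA
    exact splits_coneBlock _ _
  have hR : R.DegZero := by
    refine DegZero.list fun A hA => ?_
    obtain ⟨p, -, rfl⟩ := List.mem_map.1 hA
    exact degZero_oddPair _ _ _ _
  have hD : D.cls = ((S.fibres.drop m).map fun p => (coneBlock 1 p.1 p.2).cls).prod := by
    rw [cls_list, List.map_map]
    rfl
  have hD₂ : ((S.fibres.drop m).map fun p =>
      (coneBlock 1 p.1 p.2).cls * (coneBlock 1 p.1 p.2).cls).prod = D.cls * D.cls := by
    rw [List.prod_map_mul, ← hD]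
  have hG : (S.block (fun k => φ (S.s k)) fun j => φ (S.v j)).cls =
      ((oddPair a (η * b) c d).tensor (R.tensor B)).cls := by
    rw [cls_block, S.ofFn_deg hmn h₁ h₀ (fun d p => (coneBlock d p.1 p.2).cls), htake,
      List.map_map, List.prod_append, prod_map_flatMap_pair, ← hD, List.map_cons, List.prod_cons]
    have hR' : R.cls = (l.map fun p => (coneBlock odd (2 * p.1.1) p.1.2).cls *
        (coneBlock odd (2 * p.2.1) p.2.2).cls).prod := by
      rw [cls_list, List.map_map]
      rfl
    simp only [cls_tensor, B, hR', Function.comp_def]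
    exact mul_slide (hslide _ _) _ _ _ _
  obtain ⟨x, hx⟩ := S.presents_block φ hφh
  obtain ⟨x, hx⟩ := hx.of_cls_eq hG
  -- The kernel.
  obtain ⟨A, hA, ⟨e⟩⟩ := exists_iso_factored l
    ((coneBlock 1 a (η * b)).tensor (coneBlock 1 c d))
  obtain ⟨hB₀, ⟨e'⟩⟩ := hB
  have e₁ : PairBlock.Iso ((normalizedOddPair a (η * b) c d).tensor (ofWreath (R.tensor B)))
      ((factored A).tensor (double B)) :=
    (((normalizedOddPairIso a (η * b) c d).tensor (tensorOfWreath hR B)).trans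
      (Iso.assocInv _ _ _)).trans (e.tensor e')
  -- The fundamental group of the cover.
  have hP : ((S.cover m).block (fun _ => 1) fun _ => 1).cls = (A.tensor (B.tensor B)).cls := by
    rw [cls_block, ofFn_coneBlock]
    change (euler (-S.coverE)).cls * (((S.coverFibres m).map _).prod *
      (evenSurface S.coverType (S.coverG m)).cls) = _
    rw [coverFibres, List.map_append, List.prod_append, hl, prod_map_flatMap_pair,
      prod_map_flatMap_pair, hD₂, List.map_cons, List.prod_cons]
    simp only [cls_tensor, B, hA]
    have hV := cls_handle_pow_mul_evenSurface_sq hS.1 l.length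
    have hE := cls_coneBlock_mul_euler hS.1 l.length hη a b
    rw [← hlen] at hV hE
    exact mul_double hV hE _ _ _
  obtain ⟨z, hz⟩ := (S.cover m).presents_block 1 rfl
  obtain ⟨z, hz⟩ := hz.of_cls_eq hP
  exact presents_ker e₁ (DegZero.tensor hR hB₀) hx (fun _ => rfl) hz

end SeifertData

theorem theorem11 (S : SeifertData) (hS : S.IsValid) (m : ℕ) (hm : 0 < m) (hmn : m ≤ S.n)
    (φ : S.Pi1 →* Multiplicative (ZMod 2))
    (hφs1 : ∀ k : Fin S.n, k.val < m → φ (S.s k) = Multiplicative.ofAdd 1)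
    (hφs0 : ∀ k : Fin S.n, m ≤ k.val → φ (S.s k) = Multiplicative.ofAdd 0)
    (hφh : φ S.h = Multiplicative.ofAdd 0) :
    Even m ∧ (∀ k : Fin S.n, k.val < m → Even (S.a k)) ∧ (S.cover m).IsValid ∧
      Nonempty (φ.ker ≃* (S.cover m).Pi1) := by
  have hm₂ := SeifertData.even_card_of_deg hmn φ hφh hφs1 hφs0
  have ha : ∀ k : Fin S.n, k.val < m → Even (S.a k) :=
    fun k hk => SeifertData.even_of_deg φ hφh (hφs1 k hk)
  refine ⟨hm₂, ha, ?_, SeifertData.ker_equiv_cover hS hm hmn hm₂ ha φ hφh hφs1 hφs0⟩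
  obtain ⟨j, hj⟩ := even_iff_two_dvd.1 hm₂
  obtain ⟨j, rfl⟩ : ∃ i, j = i + 1 := ⟨j - 1, by omega⟩
  subst hj
  exact SeifertData.isValid_cover hS hmn ha
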